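/- For $f:[n]\to[m]$ let $\mathcal P_f$ be the distribution on $[m]$ with $\mathcal P_f(j)=|f^{-1}(j)|/n$. A quantum query to $f$ is an application of the unitary $O_f:|x\rangle|b\rangle\mapsto|x\rangle|b\oplus f(x)\rangle$, where $x\in[n]$ and $b,f(x)\in[m]$ are encoded as strings of $\lceil\log_2 n\rceil$ and $\lceil\log_2 m\rceil$ bits, $\oplus$ is bitwise addition modulo two, and $O_f$ acts trivially on strings $x$ that encode no element of $[n]$. For given $n$, $m$, $\epsilon$ and an explicitly known function $g:[n]\to[m]$, consider the least number of quantum queries to an unknown $f:[n]\to[m]$ made by a quantum algorithm (which may depend on $n,m,\epsilon,g$, but not on $f$) that decides, with success probability at least $2/3$, whether $\mathcal P_f=\mathcal P_g$ or $\|\mathcal P_f-\mathcal P_g\|_1=\sum_{j\in[m]}|\mathcal P_f(j)-\mathcal P_g(j)|\ge\epsilon$, for every $f$ for which one of these two cases holds. **Theorem.** This quantum query complexity is $O\!\left(\frac{m^{1/3}\log^2 m\,\log\log m}{\epsilon^5}\right)=m^{1/3}\cdot\mathrm{poly}(1/\epsilon,\log m)$. That is, there are a universal constant $C>0$ and a fixed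 real polynomial $p$ in two variables such that for all $n\ge 1$, $m\ge 3$, $\epsilon>0$ and all $g:[n]\to[m]$, the quantum query complexity is finite and is at most $C\,\frac{m^{1/3}(\log m)^2\log\log m}{\epsilon^5}$ and at most $m^{1/3}\,p(1/\epsilon,\log m)$, with natural logarithms. -/

import Mathlib

/-! ### Distributions given by functions -/

/-- The distribution on `[m]` defined by `f : [n] → [m]`: `P_f(j) = |f⁻¹(j)| / n`. -/
noncomputable def inducedDist {n m : ℕ} (f : Fin n → Fin m) (j : Fin m) : ℝ :=
  ((Finset.univ.filter fun i => f i = j).card : ℝ) / n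

/-- The `L₁`-distance `∑ j, |P j - Q j|` of two functions on `[m]`. -/
noncomputable def l1Dist {m : ℕ} (P Q : Fin m → ℝ) : ℝ :=
  ∑ j, |P j - Q j|

/-! ### Quantum query algorithms -/

/-- Labels `|x⟩|b⟩|w⟩` of the computational basis of the state space of a quantum query algorithm:
a query register `x` of `⌈log₂ n⌉` bits, an answer register `b` of `⌈log₂ m⌉` bits and a workspace
whose basis is labelled by `W`. -/
abbrev BasisLabel (n m : ℕ) (W : Type) : Type :=
  BitVec (Nat.clog 2 n) × BitVec (Nat.clog 2 m) × W

/-- The action of a query to `f` on basis labels: `|x⟩|b⟩|w⟩ ↦ |x⟩|b ⊕ f(x)⟩|w⟩`, where `⊕` is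
bitwise addition modulo two. The elements of `[n]` and `[m]` are encoded as the binary expansions
of `0, …, n - 1` and `0, …, m - 1`; strings `x` that encode no element of `[n]` are left alone. -/
def oracleLabel {n m : ℕ} (f : Fin n → Fin m) {W : Type} (s : BasisLabel n m W) :
    BasisLabel n m W :=
  (s.1, if h : s.1.toNat < n then s.2.1 ^^^ BitVec.ofNat _ (f ⟨s.1.toNat, h⟩ : ℕ) else s.2.1, s.2.2)

theorem oracleLabel_oracleLabel {n m : ℕ} (f : Fin n → Fin m) {W : Type} (s : BasisLabel n m W) :
    oracleLabel f (oracleLabel f s) = s := by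
  obtain ⟨x, b, w⟩ := s
  by_cases h : x.toNat < n <;> simp [oracleLabel, h]

/-- The oracle unitary `O_f`: it sends the basis vector with label `s` to the basis vector with
label `oracleLabel f s`. -/
def oracleUnitary {n m : ℕ} (f : Fin n → Fin m) (W : Type) [Fintype W] [DecidableEq W] :
    Matrix.unitaryGroup (BasisLabel n m W) ℂ :=
  ⟨Matrix.of fun s' s => if s' = oracleLabel f s then 1 else 0, by
    rw [Matrix.mem_unitaryGroup_iff']
    ext s t
    have hinj : oracleLabel f t = oracleLabel f s ↔ s = t :=
      ⟨fun h => by rw [← oracleLabel_oracleLabel f s, ← h, oracleLabel_oracleLabel], fun h => by rw [h]⟩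
    simp [Matrix.mul_apply, Matrix.one_apply, apply_ite star, hinj]⟩

/-- A quantum algorithm with query access to functions `[n] → [m]`: a finite-dimensional workspace,
an initial basis state, the number of queries, the (input-independent) unitaries that are applied
before, between and after the queries, and the set of outcomes of the final measurement in the
computational basis on which the algorithm accepts. Only `step 0, …, step queries` are used. -/
structure QueryAlgorithm (n m : ℕ) where
  Work : Type
  [fintypeWork : Fintype Work]
  [decidableEqWork : DecidableEq Work]
  init : BasisLabel n m Work
  queries : ℕ
  step : ℕ → Matrix.unitaryGroup (BasisLabel n m Work) ℂ
  accept : Finset (BasisLabel n m Work)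

attribute [instance] QueryAlgorithm.fintypeWork QueryAlgorithm.decidableEqWork

namespace QueryAlgorithm

/-- The state `U_k O_f U_{k-1} O_f ⋯ O_f U_0 |init⟩` of the algorithm after `k` queries to `f`. -/
noncomputable def state {n m : ℕ} (A : QueryAlgorithm n m) (f : Fin n → Fin m) :
    ℕ → BasisLabel n m A.Work → ℂ
  | 0 => (A.step 0).1.mulVec (Pi.single A.init 1)
  | k + 1 => (A.step (k + 1)).1.mulVec ((oracleUnitary f A.Work).1.mulVec (A.state f k))

/-- The probability that the algorithm accepts when it is run with the oracle for `f`. -/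
noncomputable def acceptProb {n m : ℕ} (A : QueryAlgorithm n m) (f : Fin n → Fin m) : ℝ :=
  ∑ s ∈ A.accept, ‖A.state f A.queries s‖ ^ 2

/-- The algorithm determines, with success probability at least `2/3`, whether `P_f` and `P_g` are
identical or `ε`-far, for every `f` such that one of the two is the case. -/
def Tests {n m : ℕ} (A : QueryAlgorithm n m) (ε : ℝ) (g : Fin n → Fin m) : Prop :=
  ∀ f : Fin n → Fin m,
    (inducedDist f = inducedDist g → 2 / 3 ≤ A.acceptProb f) ∧
    (ε ≤ l1Dist (inducedDist f) (inducedDist g) → 2 / 3 ≤ 1 - A.acceptProb f)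

end QueryAlgorithm

/-- The quantum query complexity of determining, given oracle access to `f : [n] → [m]` and the
known function `g : [n] → [m]`, whether `P_f` and `P_g` are identical or `ε`-far: the least number
of queries of an algorithm (which may depend on `n`, `m`, `ε` and `g`) for this task. -/
noncomputable def quantumQueryComplexity {n m : ℕ} (ε : ℝ) (g : Fin n → Fin m) : ℕ∞ :=
  ⨅ (A : QueryAlgorithm n m) (_ : A.Tests ε g), (A.queries : ℕ∞)

/-! Write `p` and `q` for the distributions of `f` and `g`. The tester first draws `s ≈ m^(1/3) /
ε^4` classical samples of `f` and, from the counts `N j`, builds a weight `w j ∈ [0, 1]` on values,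
whose main term is proportional to `N j / (q j + 1/m)`, truncated. The mean `∑ q j * w j` is known
and of order `s / M`, where `M = m + 640 s / ε^2`. If `p = q`, the mean weight under `f` is exactly
this number, whatever the samples were.

If `p` is far from `q`, then, since `N j` has mean `s * p j`, the untruncated weights together with
the sample-independent term have an expected excess `∑ (p j - q j) * w j` proportional to `s / M`
times the chi-square-like sum `∑ (p j - q j)^2 / (q j + 1/m)`, which Cauchy–Schwarz bounds below by
a multiple of `ε^2`. Truncation keeps weights at most `1` and fluctuations small. Its cost is
controlled pointwise by `truncated_mul_le` and on average by `sampleMean_truncationLoss_le`;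
`sq_div_eight_le_sum_truncatedDeviation` shows that enough of the chi-square sum survives. Chebyshev
and Markov then give an excess of order `ε^2 * s / M` for most samples
(`add_le_sum_mul_valueWeight`).

A relative excess of order `ε^2` in a mean of order `s / M` is detected with about `sqrt (M / s) /
ε^2` quantum queries (`exists_meanWeight_test`): amplitude amplification runs in superposition over
the number of iterations, and the iteration register is projected onto the vector expected for the
known mean. The projection accepts with certainty when the mean agrees. For the chosen `s` this
costs `O(m^(1/3) + 1/ε^3)` queries, so the total is within `O(m^(1/3) / ε^5)` for `ε ≤ 2`, without
logarithms; larger `ε` is trivial. -/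

/-! ### Unitary matrices and the oracle -/

open Matrix in
/-- Prescribed orthonormal columns extend to a unitary matrix. -/
theorem exists_unitary_mulVec_single {ι : Type*} [Fintype ι] [DecidableEq ι] (s : Set ι)
    (v : ι → ι → ℂ)
    (hv : ∀ i ∈ s, ∀ j ∈ s, star (v i) ⬝ᵥ v j = if i = j then 1 else 0) :
    ∃ U : Matrix.unitaryGroup ι ℂ, ∀ i ∈ s, ∀ t, U.1 t i = v i t := by
  have hon : Orthonormal ℂ (s.domRestrict fun i => (WithLp.toLp 2 (v i) : EuclideanSpace ℂ ι)) := by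
    rw [orthonormal_iff_ite]
    rintro ⟨i, hi⟩ ⟨j, hj⟩
    rw [EuclideanSpace.inner_eq_star_dotProduct]
    simp only [Set.domRestrict_apply, Subtype.mk.injEq]
    rw [dotProduct_comm]
    exact hv i hi j hj
  obtain ⟨b, hb⟩ := hon.exists_orthonormalBasis_extension_of_card_eq (by simp)
  refine ⟨⟨_, (EuclideanSpace.basisFun ι ℂ).toMatrix_orthonormalBasis_mem_unitary b⟩, ?_⟩
  intro i hi t
  simp [Module.Basis.toMatrix_apply, hb i hi]

open Matrix in
theorem Matrix.dotProduct_star_mulVec_unitary {ι : Type*} [Fintype ι] [DecidableEq ι]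
    (U : Matrix.unitaryGroup ι ℂ) (v w : ι → ℂ) :
    star (U.1 *ᵥ v) ⬝ᵥ (U.1 *ᵥ w) = star v ⬝ᵥ w := by
  rw [star_mulVec, dotProduct_mulVec, vecMul_vecMul, ← star_eq_conjTranspose,
    Matrix.mem_unitaryGroup_iff'.1 U.2, vecMul_one]

namespace QueryAlgorithm

open Matrix

variable {n m : ℕ}

theorem oracleUnitary_mulVec (f : Fin n → Fin m) {W : Type} [Fintype W] [DecidableEq W]
    (v : BasisLabel n m W → ℂ) (s : BasisLabel n m W) :
    ((oracleUnitary f W).1 *ᵥ v) s = v (oracleLabel f s) := by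
  have h : ∀ t, s = oracleLabel f t ↔ t = oracleLabel f s := fun t =>
    ⟨fun h => by rw [h, oracleLabel_oracleLabel], fun h => by rw [h, oracleLabel_oracleLabel]⟩
  simp [oracleUnitary, mulVec, dotProduct, h]

theorem oracleUnitary_mul_self (f : Fin n → Fin m) (W : Type) [Fintype W] [DecidableEq W] :
    oracleUnitary f W * oracleUnitary f W = 1 := by
  apply Subtype.ext
  apply Matrix.ext_of_mulVec_single
  intro i
  ext s
  simp only [Submonoid.coe_mul, ← mulVec_mulVec, oracleUnitary_mulVec, oracleLabel_oracleLabel,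
    Submonoid.coe_one, one_mulVec]

/-! ### Circuits with a given number of queries -/

/-- `QueryCircuit q F`: the unitary `F f` is a product of fixed unitaries and of `q` queries
to `f`. -/
inductive QueryCircuit {W : Type} [Fintype W] [DecidableEq W] :
    ℕ → ((Fin n → Fin m) → Matrix.unitaryGroup (BasisLabel n m W) ℂ) → Prop
  | const (U : Matrix.unitaryGroup (BasisLabel n m W) ℂ) : QueryCircuit 0 fun _ => U
  | query (U : Matrix.unitaryGroup (BasisLabel n m W) ℂ) {q : ℕ}
      {F : (Fin n → Fin m) → Matrix.unitaryGroup (BasisLabel n m W) ℂ} :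
      QueryCircuit q F → QueryCircuit (q + 1) fun f => U * (oracleUnitary f W * F f)

namespace QueryCircuit

variable {W : Type} [Fintype W] [DecidableEq W] {q r : ℕ}
  {F G : (Fin n → Fin m) → Matrix.unitaryGroup (BasisLabel n m W) ℂ}

theorem const_mul (U : Matrix.unitaryGroup (BasisLabel n m W) ℂ) (hF : QueryCircuit q F) :
    QueryCircuit q fun f => U * F f := by
  cases hF with
  | const V => exact const (U * V)
  | query V hF =>
    simp only [← mul_assoc U V]
    exact query (U * V) hF

theorem oracle_mul (hF : QueryCircuit q F) :
    QueryCircuit (q + 1) fun f => oracleUnitary f W * F f := by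
  simpa using query 1 hF

theorem mul (hF : QueryCircuit q F) (hG : QueryCircuit r G) :
    QueryCircuit (r + q) fun f => F f * G f := by
  induction hF with
  | const U => exact hG.const_mul U
  | query U _ ih =>
    simp only [mul_assoc]
    exact query U ih

theorem pow (hF : QueryCircuit q F) (k : ℕ) : QueryCircuit (k * q) fun f => F f ^ k := by
  induction k with
  | zero => simpa using const (n := n) (m := m) (1 : Matrix.unitaryGroup (BasisLabel n m W) ℂ)
  | succ k ih =>
    simp only [pow_succ', add_mul, one_mul]
    exact hF.mul ih

/-- Two consecutive queries cancel. Padding equalizes the query counts of circuits that are to be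
run under a common control. -/
theorem pad (hF : QueryCircuit q F) (k : ℕ) : QueryCircuit (q + 2 * k) F := by
  induction k with
  | zero => exact hF
  | succ k ih =>
    have := ih.oracle_mul.oracle_mul
    simp only [← mul_assoc, oracleUnitary_mul_self, one_mul] at this
    exact this

theorem exists_of_zero (hF : QueryCircuit 0 F) : ∃ U, F = fun _ => U := by
  cases hF with
  | const U => exact ⟨U, rfl⟩

theorem exists_of_succ (hF : QueryCircuit (q + 1) F) :
    ∃ U F', QueryCircuit q F' ∧ F = fun f => U * (oracleUnitary f W * F' f) := by
  cases hF with
  | query U hF => exact ⟨U, _, hF, rfl⟩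

theorem exists_steps (hF : QueryCircuit q F) :
    ∃ U : ℕ → Matrix.unitaryGroup (BasisLabel n m W) ℂ, ∀ (init accept),
      ∀ (V : Matrix.unitaryGroup (BasisLabel n m W) ℂ) (f : Fin n → Fin m),
      (QueryAlgorithm.mk W init q
        (fun k => if k = 0 then U 0 * V else U k) accept).state f q =
        (F f).1 *ᵥ (V.1 *ᵥ Pi.single init 1) := by
  -- The state after `q` queries depends only on steps `0, …, q`. Leaving the later steps and the
  -- recorded number `r` of queries free lets the induction append a step.
  suffices h : ∃ U : ℕ → Matrix.unitaryGroup (BasisLabel n m W) ℂ, ∀ (init accept r),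
      ∀ (V : Matrix.unitaryGroup (BasisLabel n m W) ℂ) (U' : ℕ → _) (f : Fin n → Fin m),
      (∀ k ≤ q, U' k = if k = 0 then U 0 * V else U k) →
      (QueryAlgorithm.mk W init r U' accept).state f q =
        (F f).1 *ᵥ (V.1 *ᵥ Pi.single init 1) by
    obtain ⟨U, hU⟩ := h
    exact ⟨U, fun init accept V f => hU init accept q V _ f fun _ _ => rfl⟩
  induction hF with
  | const U =>
    refine ⟨fun _ => U, fun init accept r V U' f hU => ?_⟩
    change (U' 0).1 *ᵥ Pi.single init 1 = _
    rw [hU 0 le_rfl, if_pos rfl, Submonoid.coe_mul, ← mulVec_mulVec]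
  | @query U q F hF ih =>
    obtain ⟨U₀, hU₀⟩ := ih
    refine ⟨Function.update U₀ (q + 1) U, fun init accept r V U' f hU => ?_⟩
    rw [state, hU₀ init accept r V U' f]
    · simp [hU (q + 1) le_rfl]
    · intro k hk
      rw [hU k (hk.trans (Nat.le_succ q))]
      simp [Function.update_of_ne (show k ≠ q + 1 by omega)]

end QueryCircuit

/-! ### Unitaries controlled by a part of the workspace -/

section Controlled

variable {W Ω : Type} [Fintype W] [DecidableEq W] [Fintype Ω] [DecidableEq Ω]

/-- The regrouping of the labels for a workspace of the form `Ω × W`. -/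
def splitLabel (n m : ℕ) (Ω W : Type) : BasisLabel n m (Ω × W) ≃ BasisLabel n m W × Ω where
  toFun s := ((s.1, s.2.1, s.2.2.2), s.2.2.1)
  invFun s := (s.1.1, s.1.2.1, (s.2, s.1.2.2))

/-- The unitary that applies `U ω` if the first part of the workspace is in the basis
state `ω`. -/
def controlled (U : Ω → Matrix.unitaryGroup (BasisLabel n m W) ℂ) :
    Matrix.unitaryGroup (BasisLabel n m (Ω × W)) ℂ :=
  ⟨(blockDiagonal fun ω => (U ω).1).submatrix (splitLabel n m Ω W) (splitLabel n m Ω W), by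
    rw [Matrix.mem_unitaryGroup_iff', star_eq_conjTranspose, conjTranspose_submatrix,
      blockDiagonal_conjTranspose, submatrix_mul_equiv, ← blockDiagonal_mul]
    have h : (fun ω => (U ω).1ᴴ * (U ω).1) = 1 := by
      funext ω
      exact Matrix.mem_unitaryGroup_iff'.1 (U ω).2
    rw [h, blockDiagonal_one, submatrix_one_equiv]⟩

theorem controlled_mul (U V : Ω → Matrix.unitaryGroup (BasisLabel n m W) ℂ) :
    controlled (fun ω => U ω * V ω) = controlled U * controlled V := by
  apply Subtype.ext
  simp [controlled, blockDiagonal_mul]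

theorem controlled_mulVec (U : Ω → Matrix.unitaryGroup (BasisLabel n m W) ℂ)
    (v : BasisLabel n m (Ω × W) → ℂ) (x : BitVec (Nat.clog 2 n)) (b : BitVec (Nat.clog 2 m))
    (ω : Ω) (w : W) :
    ((controlled U).1 *ᵥ v) (x, b, (ω, w)) =
      ((U ω).1 *ᵥ fun t => v (t.1, t.2.1, (ω, t.2.2))) (x, b, w) := by
  simp only [controlled, mulVec, dotProduct, submatrix_apply]
  rw [← (splitLabel n m Ω W).symm.sum_comp, Fintype.sum_prod_type]
  simp [blockDiagonal_apply, splitLabel]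

theorem oracleUnitary_prod (f : Fin n → Fin m) :
    oracleUnitary f (Ω × W) = controlled fun _ => oracleUnitary f W := by
  apply Subtype.ext
  apply Matrix.ext_of_mulVec_single
  intro i
  ext ⟨x, b, ω, w⟩
  rw [controlled_mulVec, oracleUnitary_mulVec, oracleUnitary_mulVec]
  rfl

/-- The oracle does not see the control register, so a single query serves all branches at once.
This is why the branches need equal query counts. -/
theorem QueryCircuit.controlled {q : ℕ}
    {F : Ω → (Fin n → Fin m) → Matrix.unitaryGroup (BasisLabel n m W) ℂ}
    (hF : ∀ ω, QueryCircuit q (F ω)) :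
    QueryCircuit q fun f => controlled fun ω => F ω f := by
  induction q generalizing F with
  | zero =>
    choose U hU using fun ω => (hF ω).exists_of_zero
    simp only [hU]
    exact const _
  | succ q ih =>
    choose U F' hF' hU using fun ω => (hF ω).exists_of_succ
    simp only [hU, controlled_mul, ← oracleUnitary_prod]
    exact query _ (ih hF')

end Controlled

/-! ### Acceptance probabilities -/

/-- `P f` is the acceptance probability of an algorithm with `q` queries to `f`, workspace `W` and
an arbitrary initial state. -/
def Realizes (W : Type) [Fintype W] [DecidableEq W] (q : ℕ) (P : (Fin n → Fin m) → ℝ) : Prop :=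
  ∃ (ψ : BasisLabel n m W → ℂ)
    (F : (Fin n → Fin m) → Matrix.unitaryGroup (BasisLabel n m W) ℂ)
    (S : Finset (BasisLabel n m W)),
    star ψ ⬝ᵥ ψ = 1 ∧ QueryCircuit q F ∧ ∀ f, P f = ∑ s ∈ S, ‖((F f).1 *ᵥ ψ) s‖ ^ 2

namespace Realizes

variable {W : Type} [Fintype W] [DecidableEq W] {q : ℕ}

theorem le_one {P : (Fin n → Fin m) → ℝ} (hP : Realizes W q P) (f : Fin n → Fin m) :
    P f ≤ 1 := by
  obtain ⟨ψ, F, S, hψ, -, hP⟩ := hP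
  have h : ((∑ s, ‖((F f).1 *ᵥ ψ) s‖ ^ 2 : ℝ) : ℂ) = 1 := by
    rw [← hψ, ← dotProduct_star_mulVec_unitary (F f) ψ ψ]
    simp [dotProduct, Complex.conj_mul']
  rw [hP, ← Complex.ofReal_injective (h.trans Complex.ofReal_one.symm)]
  exact Finset.sum_le_univ_sum_of_nonneg fun s => by positivity

theorem exists_queryAlgorithm [Nonempty W] {P : (Fin n → Fin m) → ℝ} (hP : Realizes W q P) :
    ∃ A : QueryAlgorithm n m, A.queries = q ∧ ∀ f, A.acceptProb f = P f := by
  obtain ⟨ψ, F, S, hψ, hF, hP⟩ := hP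
  obtain ⟨U, hU⟩ := hF.exists_steps
  let w : W := Classical.arbitrary W
  let i : BasisLabel n m W := (0, 0, w)
  obtain ⟨V, hV⟩ := exists_unitary_mulVec_single {i} (fun _ => ψ) (by simp [hψ])
  refine ⟨⟨W, i, q, fun k => if k = 0 then U 0 * V else U k, S⟩, rfl, fun f => ?_⟩
  have h : V.1 *ᵥ Pi.single i 1 = ψ := by
    ext t
    simp [hV i rfl]
  rw [hP, acceptProb]
  simp only [hU, h]

theorem one (W : Type) [Fintype W] [DecidableEq W] [Nonempty W] :
    Realizes (n := n) (m := m) W 0 fun _ => 1 := by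
  refine ⟨Pi.single (0, 0, Classical.arbitrary W) 1, fun _ => 1, Finset.univ, ?_, .const 1, ?_⟩
  · simp
  · intro f
    rw [Submonoid.coe_one, one_mulVec]
    simp [Pi.single_apply, apply_ite norm, ite_pow]

variable {Ω : Type} [Fintype Ω] [DecidableEq Ω]

/-- Averages of acceptance probabilities. -/
theorem average [Nonempty Ω] {P : Ω → (Fin n → Fin m) → ℝ} (hP : ∀ ω, Realizes W q (P ω)) :
    Realizes (Ω × W) q fun f => (∑ ω, P ω f) / Fintype.card Ω := by
  choose ψ F S hψ hF hP using hP
  have hc : (0 : ℝ) < Fintype.card Ω := by exact_mod_cast Fintype.card_pos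
  have hc' : (Fintype.card Ω : ℂ) ≠ 0 := by exact_mod_cast hc.ne'
  set a : ℂ := (Real.sqrt (Fintype.card Ω) : ℂ)⁻¹ with ha
  have haa : star a * a = (Fintype.card Ω : ℂ)⁻¹ := by
    simp only [ha, Complex.star_def, map_inv₀, Complex.conj_ofReal]
    rw [← mul_inv, ← Complex.ofReal_mul, Real.mul_self_sqrt hc.le]
    simp
  have hna : ‖a‖ ^ 2 = (Fintype.card Ω : ℝ)⁻¹ := by
    simp [ha, abs_of_nonneg (Real.sqrt_nonneg _), Real.sq_sqrt hc.le]
  -- The branches start with amplitude `1 / √|Ω|` each; the controlled circuit never mixes them, so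
  -- the final measurement averages their acceptance probabilities.
  refine ⟨fun s => a * ψ s.2.2.1 (s.1, s.2.1, s.2.2.2), fun f => controlled fun ω => F ω f,
    Finset.univ.filter fun s => (s.1, s.2.1, s.2.2.2) ∈ S s.2.2.1, ?_, .controlled hF, ?_⟩
  · simp only [dotProduct, Pi.star_apply]
    rw [← (splitLabel n m Ω W).symm.sum_comp, Fintype.sum_prod_type_right]
    have h : ∀ ω, ∑ s : BasisLabel n m W, star (ψ ω s) * ψ ω s = 1 := hψ
    simp only [splitLabel, Equiv.coe_fn_symm_mk, star_mul', mul_mul_mul_comm, haa,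
      ← Finset.mul_sum, h]
    simp [hc']
  · intro f
    rw [Finset.sum_filter, ← (splitLabel n m Ω W).symm.sum_comp, Fintype.sum_prod_type_right]
    simp only [div_eq_inv_mul, Finset.mul_sum]
    refine Finset.sum_congr rfl fun ω _ => ?_
    simp only [splitLabel, Equiv.coe_fn_symm_mk, controlled_mulVec]
    rw [hP, ← Finset.sum_filter, Finset.filter_mem_eq_inter, Finset.univ_inter, Finset.mul_sum]
    refine Finset.sum_congr rfl fun s _ => ?_
    have h : (fun t : BasisLabel n m W => a * ψ ω (t.1, t.2.1, t.2.2)) = a • ψ ω := rfl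
    rw [h, mulVec_smul, Pi.smul_apply, smul_eq_mul, norm_mul, mul_pow, hna]

/-- A query at a fixed point, followed by an algorithm that depends on the answer. -/
theorem bind_bitVec [Nonempty W] (i : Fin n)
    {P : BitVec (Nat.clog 2 m) → (Fin n → Fin m) → ℝ} (hP : ∀ b, Realizes W q (P b)) :
    Realizes (BitVec (Nat.clog 2 m) × W) (q + 1) fun f => P (BitVec.ofNat _ (f i : ℕ)) f := by
  choose ψ F S hψ hF hP using hP
  let w : W := Classical.arbitrary W
  let e : BitVec (Nat.clog 2 m) → BasisLabel n m (BitVec (Nat.clog 2 m) × W) := fun b =>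
    (BitVec.ofNat _ (i : ℕ), b, (0, w))
  let v : BasisLabel n m (BitVec (Nat.clog 2 m) × W) →
      BasisLabel n m (BitVec (Nat.clog 2 m) × W) → ℂ := fun s t =>
    if t.2.2.1 = s.2.1 then ψ s.2.1 (t.1, t.2.1, t.2.2.2) else 0
  -- `U` moves the answer `b` into the new workspace register and replaces the rest by the initial
  -- state `ψ b`. The images are orthonormal because different answers are kept in orthogonal
  -- register states.
  obtain ⟨U, hU⟩ := exists_unitary_mulVec_single (Set.range e) v (by
    rintro _ ⟨b, rfl⟩ _ ⟨b', rfl⟩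
    simp only [dotProduct, Pi.star_apply, v, e]
    rw [← (splitLabel n m _ W).symm.sum_comp, Fintype.sum_prod_type_right]
    by_cases h : b = b'
    · subst h
      have := hψ b
      simp only [dotProduct, Pi.star_apply] at this
      simp only [splitLabel, Equiv.coe_fn_symm_mk, if_true]
      rw [Finset.sum_eq_single b]
      · simpa using this
      · intro c _ hc
        simp [hc]
      · simp
    · simp only [splitLabel, Equiv.coe_fn_symm_mk]
      rw [Finset.sum_eq_zero]
      · simp [h]
      · intro c _
        refine Finset.sum_eq_zero fun t _ => ?_
        by_cases hc : c = b
        · subst hc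
          simp [h]
        · simp [hc])
  refine ⟨Pi.single (e 0) 1,
    fun f => controlled (fun b => F b f) * (U * (oracleUnitary f _ * 1)),
    Finset.univ.filter fun s => (s.1, s.2.1, s.2.2.2) ∈ S s.2.2.1, by simp, ?_, ?_⟩
  · simpa [add_comm] using (QueryCircuit.controlled hF).mul (.query U (.const 1))
  · intro f
    set b₀ : BitVec (Nat.clog 2 m) := BitVec.ofNat _ (f i : ℕ) with hb₀
    have hi : (i : ℕ) % 2 ^ Nat.clog 2 n = i :=
      Nat.mod_eq_of_lt (i.2.trans_le (Nat.le_pow_clog one_lt_two n))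
    have hO : (oracleUnitary f (BitVec (Nat.clog 2 m) × W)).1 *ᵥ Pi.single (e 0) 1 =
        Pi.single (e b₀) 1 := by
      have h1 : oracleLabel f (e 0) = e b₀ := by
        simp [oracleLabel, e, hi, hb₀]
      ext s
      rw [oracleUnitary_mulVec]
      have h2 : oracleLabel f s = e 0 ↔ s = e b₀ := by
        rw [← h1]
        exact ⟨fun h => by rw [← h, oracleLabel_oracleLabel],
          fun h => by rw [h, oracleLabel_oracleLabel]⟩
      rw [Pi.single_apply, Pi.single_apply]
      simp only [h2]
    have hUs : U.1 *ᵥ Pi.single (e b₀) 1 = v (e b₀) := by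
      ext t
      simp [hU _ ⟨b₀, rfl⟩]
    simp only [mul_one, Submonoid.coe_mul, ← mulVec_mulVec, hO, hUs]
    rw [Finset.sum_filter, ← (splitLabel n m _ W).symm.sum_comp, Fintype.sum_prod_type_right]
    simp only [splitLabel, Equiv.coe_fn_symm_mk, controlled_mulVec]
    rw [Finset.sum_eq_single b₀]
    · rw [hP, ← Finset.sum_filter, Finset.filter_mem_eq_inter, Finset.univ_inter]
      refine Finset.sum_congr rfl fun s _ => ?_
      simp only [v, e, if_true]
      rfl
    · intro b _ hb
      refine Finset.sum_eq_zero fun s _ => ?_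
      have : (fun t : BasisLabel n m W => v (e b₀) (t.1, t.2.1, (b, t.2.2))) = 0 := by
        funext t
        simp [v, e, hb]
      simp [this]
    · simp

theorem bind [Nonempty W] [NeZero m] (i : Fin n) {P : Fin m → (Fin n → Fin m) → ℝ}
    (hP : ∀ j, Realizes W q (P j)) :
    Realizes (BitVec (Nat.clog 2 m) × W) (q + 1) fun f => P (f i) f := by
  let dec : BitVec (Nat.clog 2 m) → Fin m := fun b =>
    if h : b.toNat < m then ⟨b.toNat, h⟩ else 0
  have h := bind_bitVec i fun b => hP (dec b)
  have hdec : ∀ j : Fin m, dec (BitVec.ofNat _ (j : ℕ)) = j := by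
    intro j
    have hj : (j : ℕ) % 2 ^ Nat.clog 2 m = j :=
      Nat.mod_eq_of_lt (j.2.trans_le (Nat.le_pow_clog one_lt_two m))
    simp [dec, hj]
  simpa only [hdec] using h

/-- A query at a uniformly random point, followed by an algorithm that depends on the answer. -/
theorem sample [Nonempty W] [NeZero n] [NeZero m] {P : Fin m → (Fin n → Fin m) → ℝ}
    (hP : ∀ j, Realizes W q (P j)) :
    Realizes (Fin n × (BitVec (Nat.clog 2 m) × W)) (q + 1)
      fun f => (∑ i, P (f i) f) / n := by
  simpa using average (Ω := Fin n) fun i => bind i hP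

end Realizes

end QueryAlgorithm

/-! ### Amplitude amplification -/

open Matrix in
/-- The reflection `2|v⟩⟨v| - 1` about a unit vector. -/
def reflectionUnitary {ι : Type*} [Fintype ι] [DecidableEq ι] (v : ι → ℂ) (hv : star v ⬝ᵥ v = 1) :
    Matrix.unitaryGroup ι ℂ :=
  ⟨(2 : ℂ) • vecMulVec v (star v) - 1, by
    rw [Matrix.mem_unitaryGroup_iff', star_eq_conjTranspose]
    have h : ((2 : ℂ) • vecMulVec v (star v) - 1)ᴴ = (2 : ℂ) • vecMulVec v (star v) - 1 := by
      rw [conjTranspose_sub, conjTranspose_smul, conjTranspose_vecMulVec, star_star,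
        conjTranspose_one]
      simp
    rw [h, sub_mul, mul_sub, smul_mul_smul_comm, vecMulVec_mul_vecMulVec, hv, one_smul]
    simp only [mul_one, one_mul]
    module⟩

open Matrix in
theorem reflectionUnitary_mulVec {ι : Type*} [Fintype ι] [DecidableEq ι] (v : ι → ℂ)
    (hv : star v ⬝ᵥ v = 1) (φ : ι → ℂ) :
    (reflectionUnitary v hv).1 *ᵥ φ = (2 * (star v ⬝ᵥ φ)) • v - φ := by
  simp only [reflectionUnitary, sub_mulVec, smul_mulVec, vecMulVec_mulVec, one_mulVec]
  ext i
  simp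
  ring

/-- The coefficients, relative to the initial state, of the unmarked part (`false`) and of the
marked part (`true`) of the state after `k` steps of amplitude amplification, where `a` is the
initial probability of the marked part. -/
noncomputable def groverCoeff (a : ℝ) : ℕ → Bool → ℝ
  | 0, _ => 1
  | k + 1, c => 2 * (groverCoeff a k false * (1 - a) - groverCoeff a k true * a) +
      (if c then 1 else -1) * groverCoeff a k c

/-- The initial amplitudes are `cos θ` and `sin θ`, and every iteration rotates by `2θ`. Multiplying
by them instead of dividing keeps the cases `a = 0` and `a = 1`. -/
theorem groverCoeff_sin_sq (θ : ℝ) (k : ℕ) :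
    groverCoeff (Real.sin θ ^ 2) k false * Real.cos θ = Real.cos ((2 * k + 1) * θ) ∧
      groverCoeff (Real.sin θ ^ 2) k true * Real.sin θ = Real.sin ((2 * k + 1) * θ) := by
  induction k with
  | zero => simp [groverCoeff]
  | succ k ih =>
    obtain ⟨h1, h2⟩ := ih
    have h3 : (2 * ((k + 1 : ℕ) : ℝ) + 1) * θ = (2 * k + 1) * θ + 2 * θ := by push_cast; ring
    have h4 := Real.sin_sq_add_cos_sq θ
    rw [h3, Real.cos_add, Real.sin_add, Real.cos_two_mul, Real.sin_two_mul, ← h1, ← h2]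
    constructor
    · simp only [groverCoeff, Bool.false_eq_true, if_false]
      linear_combination (-2 * groverCoeff (Real.sin θ ^ 2) k false * Real.cos θ) * h4
    · simp only [groverCoeff, if_true]
      linear_combination (-2 * groverCoeff (Real.sin θ ^ 2) k false * Real.sin θ) * h4 -
        2 * groverCoeff (Real.sin θ ^ 2) k true * Real.sin θ * h4

namespace QueryAlgorithm

open Matrix

variable {n m : ℕ}

theorem toNat_ofNat_clog (i : Fin n) : (BitVec.ofNat (Nat.clog 2 n) (i : ℕ)).toNat = i := by
  rw [BitVec.toNat_ofNat]
  exact Nat.mod_eq_of_lt (i.2.trans_le (Nat.le_pow_clog one_lt_two n))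

/-- The label `|i⟩|f(i)⟩|c⟩`. -/
def graphLabel (f : Fin n → Fin m) (p : Fin n × Bool) : BasisLabel n m Bool :=
  (BitVec.ofNat _ (p.1 : ℕ), BitVec.ofNat _ (f p.1 : ℕ), p.2)

theorem graphLabel_injective (f : Fin n → Fin m) : Function.Injective (graphLabel f) := by
  rintro ⟨i, c⟩ ⟨j, d⟩ h
  simp only [graphLabel, Prod.mk.injEq] at h
  have := congrArg BitVec.toNat h.1
  rw [toNat_ofNat_clog, toNat_ofNat_clog] at this
  exact Prod.ext (Fin.ext this) h.2.2

/-- The uniform superposition of the elements of `[n]`. -/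
noncomputable def uniformState (n m : ℕ) (s : BasisLabel n m Bool) : ℂ :=
  if s.1.toNat < n ∧ s.2.1 = 0 ∧ s.2.2 = false then ((Real.sqrt n)⁻¹ : ℝ) else 0

/-- The amplitude of the flag value `c` for the weight `w`. -/
noncomputable def flagAmplitude (w : ℝ) (c : Bool) : ℝ :=
  if c then Real.sqrt w else Real.sqrt (1 - w)

theorem flagAmplitude_sq {w : ℝ} (hw : 0 ≤ w) (hw' : w ≤ 1) (c : Bool) :
    flagAmplitude w c ^ 2 = if c then w else 1 - w := by
  cases c
  · simp [flagAmplitude, Real.sq_sqrt (sub_nonneg.2 hw')]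
  · simp [flagAmplitude, Real.sq_sqrt hw]

/-- The superposition of all `|i⟩|f(i)⟩` with a flag rotated according to the weight of `f(i)`. -/
noncomputable def flaggedState (w : BitVec (Nat.clog 2 m) → ℝ) (f : Fin n → Fin m)
    (s : BasisLabel n m Bool) : ℂ :=
  if h : s.1.toNat < n then
    if s.2.1 = BitVec.ofNat _ (f ⟨s.1.toNat, h⟩ : ℕ) then
      ((Real.sqrt n)⁻¹ * flagAmplitude (w s.2.1) s.2.2 : ℝ) else 0
  else 0

theorem flaggedState_graphLabel (w : BitVec (Nat.clog 2 m) → ℝ) (f : Fin n → Fin m)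
    (p : Fin n × Bool) :
    flaggedState w f (graphLabel f p) =
      ((Real.sqrt n)⁻¹ * flagAmplitude (w (BitVec.ofNat _ (f p.1 : ℕ))) p.2 : ℝ) := by
  have h : (graphLabel f p).1.toNat < n := (toNat_ofNat_clog p.1).trans_lt p.1.2
  have h' : (⟨(graphLabel f p).1.toNat, h⟩ : Fin n) = p.1 := Fin.ext (toNat_ofNat_clog p.1)
  rw [flaggedState, dif_pos h, h']
  exact if_pos rfl

theorem flaggedState_eq_zero (w : BitVec (Nat.clog 2 m) → ℝ) (f : Fin n → Fin m)
    {s : BasisLabel n m Bool} (hs : s ∉ Set.range (graphLabel f)) : flaggedState w f s = 0 := by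
  unfold flaggedState
  split_ifs with h h'
  · refine (hs ⟨(⟨s.1.toNat, h⟩, s.2.2), ?_⟩).elim
    simp [graphLabel, ← h']
  · rfl
  · rfl

/-- The mean weight `𝔼 w(f(i))`. -/
noncomputable def meanWeight (w : BitVec (Nat.clog 2 m) → ℝ) (f : Fin n → Fin m) : ℝ :=
  (∑ i, w (BitVec.ofNat _ (f i : ℕ))) / n

theorem sum_norm_flaggedState [NeZero n] {w : BitVec (Nat.clog 2 m) → ℝ} (hw : ∀ b, 0 ≤ w b)
    (hw' : ∀ b, w b ≤ 1) (f : Fin n → Fin m) (g : Bool → ℝ) :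
    ∑ s : BasisLabel n m Bool, g s.2.2 * ‖flaggedState w f s‖ ^ 2 =
      g false * (1 - meanWeight w f) + g true * meanWeight w f := by
  have hn : (n : ℝ) ≠ 0 := by exact_mod_cast NeZero.ne n
  rw [← Fintype.sum_of_injective (graphLabel f) (graphLabel_injective f)
    (fun p => g p.2 * ‖flaggedState w f (graphLabel f p)‖ ^ 2) _ ?_ fun _ => rfl]
  · simp only [flaggedState_graphLabel, Complex.norm_real, Real.norm_eq_abs, sq_abs, mul_pow,
      flagAmplitude_sq (hw _) (hw' _), inv_pow, Real.sq_sqrt (Nat.cast_nonneg n)]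
    rw [Fintype.sum_prod_type]
    simp only [Fintype.sum_bool, if_true, Bool.false_eq_true, if_false, Finset.sum_add_distrib,
      ← Finset.mul_sum, Finset.sum_sub_distrib, meanWeight]
    simp
    field_simp
    ring
  · intro s hs
    simp [flaggedState_eq_zero w f hs]

theorem dotProduct_flaggedState [NeZero n] {w : BitVec (Nat.clog 2 m) → ℝ} (hw : ∀ b, 0 ≤ w b)
    (hw' : ∀ b, w b ≤ 1) (f : Fin n → Fin m) (g : Bool → ℝ) :
    star (flaggedState w f) ⬝ᵥ (fun s => (g s.2.2 : ℂ) * flaggedState w f s) =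
      ((g false * (1 - meanWeight w f) + g true * meanWeight w f : ℝ) : ℂ) := by
  rw [← sum_norm_flaggedState hw hw', Complex.ofReal_sum]
  refine Finset.sum_congr rfl fun s _ => ?_
  rw [Pi.star_apply, Complex.star_def, mul_left_comm, Complex.conj_mul']
  push_cast
  rfl

/-- After one query the value is in the answer register, so a rotation of the flag controlled by
that register is independent of `f`. Only its action on labels with flag `false` has to be
prescribed. -/
theorem exists_flagRotation {w : BitVec (Nat.clog 2 m) → ℝ} (hw : ∀ b, 0 ≤ w b)
    (hw' : ∀ b, w b ≤ 1) :
    ∃ R : Matrix.unitaryGroup (BasisLabel n m Bool) ℂ, ∀ f : Fin n → Fin m,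
      (R * oracleUnitary f Bool).1 *ᵥ uniformState n m = flaggedState w f := by
  obtain ⟨R, hR⟩ := exists_unitary_mulVec_single
    {s : BasisLabel n m Bool | s.2.2 = false}
    (fun s t => if t.1 = s.1 ∧ t.2.1 = s.2.1 then (flagAmplitude (w s.2.1) t.2.2 : ℂ) else 0) (by
      rintro ⟨x, b, c⟩ hc ⟨x', b', c'⟩ hc'
      simp only [Set.mem_ofPred_eq] at hc hc'
      subst hc hc'
      simp only [dotProduct, Pi.star_apply]
      have h1 : (flagAmplitude (w b) true : ℂ) * flagAmplitude (w b) true +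
          flagAmplitude (w b) false * flagAmplitude (w b) false = 1 := by
        rw [← Complex.ofReal_mul, ← Complex.ofReal_mul, ← sq, ← sq, flagAmplitude_sq (hw b) (hw' b),
          flagAmplitude_sq (hw b) (hw' b)]
        simp
      by_cases h : x = x' ∧ b = b'
      · obtain ⟨rfl, rfl⟩ := h
        simp [Fintype.sum_prod_type, ite_and, h1]
      · rw [Finset.sum_eq_zero]
        · rw [if_neg]
          simpa using h
        · rintro ⟨y, d, e⟩ -
          by_cases h' : y = x ∧ d = b
          · obtain ⟨rfl, rfl⟩ := h'
            simp [h]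
          · simp [h'])
  refine ⟨R, fun f => ?_⟩
  ext ⟨x, b, c⟩
  rw [Submonoid.coe_mul, ← mulVec_mulVec, mulVec_eq_sum, Finset.sum_apply]
  rw [Finset.sum_eq_single (x, b, false)]
  · rw [oracleUnitary_mulVec]
    simp only [Pi.smul_apply, MulOpposite.smul_eq_mul_unop, MulOpposite.unop_op, transpose_apply]
    rw [hR _ rfl]
    by_cases hx : x.toNat < n
    · simp [uniformState, oracleLabel, flaggedState, hx, mul_comm]
    · simp [uniformState, oracleLabel, flaggedState, hx]
  · rintro ⟨y, d, e⟩ - hs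
    rw [oracleUnitary_mulVec]
    cases e
    · have h : ¬(x = y ∧ b = d) := fun h => hs (by rw [h.1, h.2])
      simp [hR (y, d, false) rfl, h]
    · simp [uniformState, oracleLabel]
  · simp

theorem uniformState_norm [NeZero n] [NeZero m] :
    star (uniformState n m) ⬝ᵥ uniformState n m = 1 := by
  obtain ⟨R, hR⟩ := exists_flagRotation (n := n) (m := m) (w := fun _ => 0)
    (fun _ => le_rfl) (fun _ => zero_le_one)
  let f : Fin n → Fin m := fun _ => 0
  rw [← dotProduct_star_mulVec_unitary (R * oracleUnitary f Bool), hR]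
  simpa using dotProduct_flaggedState (n := n) (w := fun _ => 0) (fun _ => le_rfl)
    (fun _ => zero_le_one) f fun _ => 1

/-- The phase flip of the marked part. -/
def flagFlip (n m : ℕ) : Matrix.unitaryGroup (BasisLabel n m Bool) ℂ :=
  ⟨diagonal fun s => if s.2.2 then -1 else 1, by
    rw [Matrix.mem_unitaryGroup_iff', star_eq_conjTranspose, diagonal_conjTranspose,
      diagonal_mul_diagonal, ← diagonal_one]
    congr 1
    funext s
    by_cases h : s.2.2 <;> simp [h]⟩

/-- Amplitude amplification: `k` iterations use `2k + 1` queries. -/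
theorem exists_amplification [NeZero n] [NeZero m] {w : BitVec (Nat.clog 2 m) → ℝ}
    (hw : ∀ b, 0 ≤ w b) (hw' : ∀ b, w b ≤ 1) :
    ∃ F : ℕ → (Fin n → Fin m) → Matrix.unitaryGroup (BasisLabel n m Bool) ℂ,
      (∀ k, QueryCircuit (1 + k * 2) (F k)) ∧
      ∀ k f, (F k f).1 *ᵥ uniformState n m =
        fun s => (groverCoeff (meanWeight w f) k s.2.2 : ℂ) * flaggedState w f s := by
  obtain ⟨R, hR⟩ := exists_flagRotation (n := n) hw hw'
  let D := reflectionUnitary (uniformState n m) uniformState_norm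
  -- With `M = R * O_f`, which prepares the flagged state, this is `M * D * M⁻¹` after the phase
  -- flip: a reflection about the flagged state. Both `M` and `M⁻¹` cost one query.
  let G : (Fin n → Fin m) → Matrix.unitaryGroup (BasisLabel n m Bool) ℂ := fun f =>
    R * (oracleUnitary f Bool * (D * (oracleUnitary f Bool * (R⁻¹ * flagFlip n m))))
  have hG : QueryCircuit 2 G := .query R (.query D (.const _))
  refine ⟨fun k f => G f ^ k * (R * (oracleUnitary f Bool * 1)),
    fun k => (hG.pow k).mul (.query R (.const 1)), fun k f => ?_⟩
  have hstep : ∀ φ, (G f).1 *ᵥ φ = (2 * (star (flaggedState w f) ⬝ᵥ ((flagFlip n m).1 *ᵥ φ))) •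
      flaggedState w f - (flagFlip n m).1 *ᵥ φ := by
    intro φ
    set M := R * oracleUnitary f Bool with hM
    have hMi : oracleUnitary f Bool * R⁻¹ = M⁻¹ := by
      rw [hM, _root_.mul_inv_rev, inv_eq_of_mul_eq_one_left (oracleUnitary_mul_self f Bool)]
    have hGM : G f = M * (D * (M⁻¹ * flagFlip n m)) := by
      rw [← hMi, hM]
      simp only [G, mul_assoc]
    have hMM : ∀ φ, M.1 *ᵥ ((M⁻¹).1 *ᵥ φ) = φ := by
      intro φ
      rw [mulVec_mulVec, ← Submonoid.coe_mul, mul_inv_cancel, Submonoid.coe_one, one_mulVec]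
    rw [hGM]
    simp only [Submonoid.coe_mul, ← mulVec_mulVec]
    rw [reflectionUnitary_mulVec, mulVec_sub, mulVec_smul, hMM, hR,
      ← dotProduct_star_mulVec_unitary M, hR, hMM]
  induction k with
  | zero =>
    simp only [pow_zero, one_mul, mul_one, hR, groverCoeff]
    simp
  | succ k ih =>
    dsimp only at ih ⊢
    rw [pow_succ', mul_assoc, Submonoid.coe_mul, ← mulVec_mulVec, ih, hstep]
    have hflip : (flagFlip n m).1 *ᵥ
        (fun s => (groverCoeff (meanWeight w f) k s.2.2 : ℂ) * flaggedState w f s) =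
        fun s => (((if s.2.2 then -1 else 1) * groverCoeff (meanWeight w f) k s.2.2 : ℝ) : ℂ) *
          flaggedState w f s := by
      funext s
      simp only [flagFlip, mulVec_diagonal]
      by_cases h : s.2.2 <;> simp [h]
    rw [hflip, dotProduct_flaggedState hw hw' f
      fun c => (if c then -1 else 1) * groverCoeff (meanWeight w f) k c]
    funext s
    obtain ⟨x, b, c⟩ := s
    cases c <;> simp [groverCoeff] <;> ring

/-- Amplitude amplification for a superposition of iteration numbers, followed by a measurement
of the iteration number relative to unit vectors that depend on the flag. -/
theorem realizes_amplitudeTest [NeZero n] [NeZero m] {w : BitVec (Nat.clog 2 m) → ℝ}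
    (hw : ∀ b, 0 ≤ w b) (hw' : ∀ b, w b ≤ 1) {K : ℕ} [NeZero K] (e : Bool → Fin K → ℝ)
    (he : ∀ c, ∑ k, e c k ^ 2 = 1) :
    Realizes (n := n) (Fin K × Bool) (2 * K + 1) fun f =>
      ((1 - meanWeight w f) * (∑ k, e false k * groverCoeff (meanWeight w f) k false) ^ 2 +
        meanWeight w f * (∑ k, e true k * groverCoeff (meanWeight w f) k true) ^ 2) / K := by
  obtain ⟨F, hF, hFs⟩ := exists_amplification (n := n) hw hw'
  have hK : (0 : ℝ) < K := by exact_mod_cast NeZero.pos K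
  have hK' : (K : ℂ) ≠ 0 := by exact_mod_cast hK.ne'
  let v : BasisLabel n m (Fin K × Bool) → BasisLabel n m (Fin K × Bool) → ℂ := fun s t =>
    if t.1 = s.1 ∧ t.2.1 = s.2.1 ∧ t.2.2.2 = s.2.2.2 then (e s.2.2.2 t.2.2.1 : ℂ) else 0
  have hvsum : ∀ (s : BasisLabel n m (Fin K × Bool)) (φ : BasisLabel n m (Fin K × Bool) → ℂ),
      star (v s) ⬝ᵥ φ = ∑ k, (e s.2.2.2 k : ℂ) * φ (s.1, s.2.1, (k, s.2.2.2)) := by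
    intro s φ
    simp only [dotProduct, Pi.star_apply, v]
    rw [← (splitLabel n m (Fin K) Bool).symm.sum_comp, Fintype.sum_prod_type_right]
    refine Finset.sum_congr rfl fun k _ => ?_
    rw [Finset.sum_eq_single (s.1, s.2.1, s.2.2.2)]
    · simp [splitLabel]
    · rintro ⟨x, b, c⟩ - h
      rw [if_neg]
      · simp
      · rintro ⟨rfl, rfl, rfl⟩
        exact h rfl
    · simp
  -- `V` sends iteration register `0` with flag `c` to the vector `e c`. Hence applying `V⁻¹` and
  -- observing register `0` is the projection onto `e c`.
  obtain ⟨V, hV⟩ := exists_unitary_mulVec_single {s | s.2.2.1 = 0} v (by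
    rintro ⟨x, b, k, c⟩ hk ⟨x', b', k', c'⟩ hk'
    simp only [Set.mem_ofPred_eq] at hk hk'
    subst hk hk'
    rw [hvsum]
    by_cases h : x = x' ∧ b = b' ∧ c = c'
    · obtain ⟨rfl, rfl, rfl⟩ := h
      have := he c
      simp only [v, and_self, if_true, ← sq]
      exact_mod_cast this
    · simp [v, h])
  have hVs : ∀ φ (s : BasisLabel n m (Fin K × Bool)), s.2.2.1 = 0 → ((V⁻¹).1 *ᵥ φ) s =
      ∑ k, (e s.2.2.2 k : ℂ) * φ (s.1, s.2.1, (k, s.2.2.2)) := by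
    intro φ s hs
    rw [← hvsum]
    simp only [mulVec, dotProduct, Pi.star_apply]
    refine Finset.sum_congr rfl fun t _ => ?_
    rw [← hV s hs]
    rfl
  set a : ℂ := (Real.sqrt K : ℂ)⁻¹ with ha
  have haa : star a * a = (K : ℂ)⁻¹ := by
    simp only [ha, Complex.star_def, map_inv₀, Complex.conj_ofReal]
    rw [← mul_inv, ← Complex.ofReal_mul, Real.mul_self_sqrt hK.le]
    simp
  have hna : ‖a‖ ^ 2 = (K : ℝ)⁻¹ := by
    simp [ha, abs_of_nonneg (Real.sqrt_nonneg _), Real.sq_sqrt hK.le]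
  refine ⟨fun s => a * uniformState n m (s.1, s.2.1, s.2.2.2),
    fun f => V⁻¹ * controlled fun k : Fin K => F k f,
    Finset.univ.filter fun s => s.2.2.1 = 0, ?_,
    (QueryCircuit.controlled fun k : Fin K => ?_).const_mul _, ?_⟩
  · simp only [dotProduct, Pi.star_apply]
    rw [← (splitLabel n m (Fin K) Bool).symm.sum_comp, Fintype.sum_prod_type_right]
    have h : ∑ s, star (uniformState n m s) * uniformState n m s = 1 := uniformState_norm
    simp only [splitLabel, Equiv.coe_fn_symm_mk, star_mul', mul_mul_mul_comm, haa,
      ← Finset.mul_sum, h]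
    simp [hK']
  -- The branch with `k` iterations uses `2k + 1` queries and is padded to the common `2K + 1`.
  · have := (hF k).pad (K - k)
    rwa [show 1 + (k : ℕ) * 2 + 2 * (K - k) = 2 * K + 1 by omega] at this
  · intro f
    have hctrl : (controlled fun k : Fin K => F k f).1 *ᵥ
        (fun s => a * uniformState n m (s.1, s.2.1, s.2.2.2)) =
        fun s => a * ((groverCoeff (meanWeight w f) s.2.2.1 s.2.2.2 : ℂ) *
          flaggedState w f (s.1, s.2.1, s.2.2.2)) := by
      funext ⟨x, b, k, c⟩
      rw [controlled_mulVec]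
      have h : (fun t : BasisLabel n m Bool => a * uniformState n m (t.1, t.2.1, t.2.2)) =
        a • uniformState n m := rfl
      simp only [h, mulVec_smul, hFs]
      rfl
    have hamp : ∀ s ∈ Finset.univ.filter fun s : BasisLabel n m (Fin K × Bool) => s.2.2.1 = 0,
        ‖((V⁻¹ * controlled fun k : Fin K => F k f).1 *ᵥ
          fun s => a * uniformState n m (s.1, s.2.1, s.2.2.2)) s‖ ^ 2 =
        (∑ k, e s.2.2.2 k * groverCoeff (meanWeight w f) k s.2.2.2) ^ 2 / K *
          ‖flaggedState w f (s.1, s.2.1, s.2.2.2)‖ ^ 2 := by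
      intro s hs
      rw [Submonoid.coe_mul, ← mulVec_mulVec, hctrl, hVs _ _ (Finset.mem_filter.1 hs).2]
      have h : ∀ k : Fin K, (e s.2.2.2 k : ℂ) *
          (a * ((groverCoeff (meanWeight w f) k s.2.2.2 : ℂ) *
            flaggedState w f (s.1, s.2.1, s.2.2.2))) =
          ((e s.2.2.2 k * groverCoeff (meanWeight w f) k s.2.2.2 : ℝ) : ℂ) *
            (a * flaggedState w f (s.1, s.2.1, s.2.2.2)) := by
        intro k
        push_cast
        ring
      simp only [h]
      rw [← Finset.sum_mul, ← Complex.ofReal_sum, norm_mul, norm_mul, mul_pow, mul_pow, hna,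
        Complex.norm_real, Real.norm_eq_abs, sq_abs]
      ring
    rw [Finset.sum_congr rfl hamp, Finset.sum_filter,
      ← (splitLabel n m (Fin K) Bool).symm.sum_comp, Fintype.sum_prod_type_right,
      Finset.sum_eq_single 0]
    · have := sum_norm_flaggedState hw hw' f fun c =>
        (∑ k, e c k * groverCoeff (meanWeight w f) k c) ^ 2 / K
      simp only [splitLabel, Equiv.coe_fn_symm_mk, if_true]
      rw [this]
      ring
    · intro k _ hk
      simp [splitLabel, hk]
    · simp

end QueryAlgorithm

/-! ### Trigonometric sums and the test of a mean weight -/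

theorem Real.two_mul_sin_mul_sum_cos (φ : ℝ) (K : ℕ) :
    2 * Real.sin φ * ∑ k : Fin K, Real.cos ((2 * k + 1) * φ) = Real.sin (2 * K * φ) := by
  rw [Fin.sum_univ_eq_sum_range fun k => Real.cos ((2 * k + 1) * φ)]
  induction K with
  | zero => simp
  | succ K ih =>
    rw [Finset.sum_range_succ, mul_add, ih]
    have h1 : (2 * K : ℝ) * φ = (2 * K + 1) * φ - φ := by ring
    have h2 : (2 * ((K + 1 : ℕ) : ℝ)) * φ = (2 * K + 1) * φ + φ := by push_cast; ring
    rw [h1, h2, Real.sin_sub, Real.sin_add]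
    ring

theorem Real.abs_sum_cos_le {φ r : ℝ} (hr : 0 < r) (h : r ≤ Real.sin φ) (K : ℕ) :
    |∑ k : Fin K, Real.cos ((2 * k + 1) * φ)| ≤ 1 / (2 * r) := by
  have h1 := congrArg abs (Real.two_mul_sin_mul_sum_cos φ K)
  rw [abs_mul, abs_of_pos (by linarith : 0 < 2 * Real.sin φ)] at h1
  have h2 := Real.abs_sin_le_one (2 * K * φ)
  rw [le_div_iff₀ (by positivity)]
  nlinarith [abs_nonneg (∑ k : Fin K, Real.cos ((2 * k + 1) * φ))]

/-- Any unit vector serves if `v = 0`; this happens for the sine vector of the angle `0`. -/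
theorem exists_normalized {ι : Type*} [Fintype ι] [Nonempty ι] (v : ι → ℝ) :
    ∃ e : ι → ℝ, ∑ k, e k ^ 2 = 1 ∧ ∀ k, v k = Real.sqrt (∑ k, v k ^ 2) * e k := by
  classical
  have h0 : 0 ≤ ∑ k, v k ^ 2 := Finset.sum_nonneg fun k _ => sq_nonneg _
  rcases h0.eq_or_lt' with h | h
  · refine ⟨Pi.single (Classical.arbitrary ι) 1, by simp [Pi.single_apply, ite_pow], fun k => ?_⟩
    have := (Finset.sum_eq_zero_iff_of_nonneg fun k _ => sq_nonneg (v k)).1 h k (Finset.mem_univ k)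
    simp [h, pow_eq_zero_iff two_ne_zero |>.1 this]
  · have hs := Real.sqrt_pos.2 h
    refine ⟨fun k => v k / Real.sqrt (∑ k, v k ^ 2), ?_, fun k => by field_simp⟩
    simp only [div_pow, Real.sq_sqrt h0, ← Finset.sum_div]
    exact div_self h.ne'

/-- The vectors `(cos((2k+1)φ))ₖ` (for `false`) and `(sin((2k+1)φ))ₖ` (for `true`). -/
noncomputable def phaseVector (φ : ℝ) (c : Bool) (k : ℕ) : ℝ :=
  if c then Real.sin ((2 * k + 1) * φ) else Real.cos ((2 * k + 1) * φ)

theorem sum_phaseVector_mul (φ θ : ℝ) (c : Bool) (K : ℕ) :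
    ∑ k : Fin K, phaseVector φ c k * phaseVector θ c k =
      (∑ k : Fin K, Real.cos ((2 * k + 1) * (θ - φ)) +
        (if c then -1 else 1) * ∑ k : Fin K, Real.cos ((2 * k + 1) * (θ + φ))) / 2 := by
  rw [Finset.mul_sum, ← Finset.sum_add_distrib, Finset.sum_div]
  refine Finset.sum_congr rfl fun k _ => ?_
  have h1 : (2 * (k : ℝ) + 1) * (θ - φ) = (2 * k + 1) * θ - (2 * k + 1) * φ := by ring
  have h2 : (2 * (k : ℝ) + 1) * (θ + φ) = (2 * k + 1) * θ + (2 * k + 1) * φ := by ring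
  rw [h1, h2, Real.cos_sub, Real.cos_add]
  cases c <;> simp [phaseVector] <;> ring

namespace QueryAlgorithm

variable {n m : ℕ}

theorem meanWeight_mem [NeZero n] {w : BitVec (Nat.clog 2 m) → ℝ} (hw : ∀ b, 0 ≤ w b)
    (hw' : ∀ b, w b ≤ 1) (f : Fin n → Fin m) : 0 ≤ meanWeight w f ∧ meanWeight w f ≤ 1 := by
  have hn : (0 : ℝ) < n := by exact_mod_cast NeZero.pos n
  refine ⟨div_nonneg (Finset.sum_nonneg fun i _ => hw _) hn.le, (div_le_one hn).2 ?_⟩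
  simpa using Finset.sum_le_sum fun (i : Fin n) (_ : i ∈ Finset.univ) =>
    hw' (BitVec.ofNat _ (f i : ℕ))

/-- A test that distinguishes a given mean weight `a₀` from larger ones. -/
theorem exists_meanWeight_test [NeZero n] [NeZero m] {w : BitVec (Nat.clog 2 m) → ℝ}
    (hw : ∀ b, 0 ≤ w b) (hw' : ∀ b, w b ≤ 1) (K : ℕ) [NeZero K] {a₀ : ℝ} (ha₀ : 0 ≤ a₀)
    (ha₀' : a₀ ≤ 1) :
    ∃ P : (Fin n → Fin m) → ℝ, Realizes (Fin K × Bool) (2 * K + 1) P ∧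
      ∀ f, (meanWeight w f = a₀ → P f = 1) ∧
        ∀ r : ℝ, 0 < r → a₀ ≤ 1 / 2 → 1 ≤ K * Real.sqrt a₀ → 5 ≤ K * r →
          Real.sqrt a₀ + r ≤ Real.sqrt (meanWeight w f) → P f ≤ 2 / 25 := by
  have hK : (0 : ℝ) < K := by exact_mod_cast NeZero.pos K
  have hangle : ∀ a : ℝ, 0 ≤ a → a ≤ 1 → ∃ θ, Real.sin θ = Real.sqrt a ∧
      Real.cos θ = Real.sqrt (1 - a) := by
    intro a h0 h1
    refine ⟨Real.arcsin (Real.sqrt a), Real.sin_arcsin (by linarith [Real.sqrt_nonneg a])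
      (Real.sqrt_le_one.2 h1), ?_⟩
    rw [Real.cos_arcsin, Real.sq_sqrt h0]
  obtain ⟨φ, hsφ, hcφ⟩ := hangle a₀ ha₀ ha₀'
  choose e he hev using fun c => exists_normalized fun k : Fin K => phaseVector φ c k
  refine ⟨_, realizes_amplitudeTest hw hw' e he, fun f => ?_⟩
  obtain ⟨h0, h1⟩ := meanWeight_mem hw hw' f
  set a := meanWeight w f with ha
  obtain ⟨θ, hsθ, hcθ⟩ := hangle a h0 h1
  have hsa : Real.sin θ ^ 2 = a := by rw [hsθ, Real.sq_sqrt h0]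
  have hca : Real.cos θ ^ 2 = 1 - a := by rw [hcθ, Real.sq_sqrt (by linarith)]
  have hfalse : (1 - a) * (∑ k, e false k * groverCoeff a k false) ^ 2 =
      (∑ k, e false k * phaseVector θ false k) ^ 2 := by
    rw [← hca, ← mul_pow, Finset.mul_sum]
    congr 1
    refine Finset.sum_congr rfl fun k _ => ?_
    have := (groverCoeff_sin_sq θ k).1
    rw [hsa] at this
    simp only [phaseVector, Bool.false_eq_true, if_false]
    rw [← this]
    ring
  have htrue : a * (∑ k, e true k * groverCoeff a k true) ^ 2 =
      (∑ k, e true k * phaseVector θ true k) ^ 2 := by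
    rw [← hsa, ← mul_pow, Finset.mul_sum, hsa]
    congr 1
    refine Finset.sum_congr rfl fun k _ => ?_
    have := (groverCoeff_sin_sq θ k).2
    rw [hsa] at this
    simp only [phaseVector, if_true]
    rw [← this]
    ring
  have hN : ∀ c, 0 ≤ ∑ k : Fin K, phaseVector φ c k ^ 2 := fun c =>
    Finset.sum_nonneg fun k _ => sq_nonneg _
  have hprod : ∀ c, (∑ k : Fin K, phaseVector φ c k ^ 2) *
      (∑ k, e c k * phaseVector θ c k) ^ 2 =
      (∑ k : Fin K, phaseVector φ c k * phaseVector θ c k) ^ 2 := by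
    intro c
    nth_rewrite 1 [← Real.sq_sqrt (hN c)]
    rw [← mul_pow, Finset.mul_sum]
    congr 1
    refine Finset.sum_congr rfl fun k _ => ?_
    rw [hev c k]
    ring
  simp only [hfalse, htrue]
  constructor
  · intro h
    -- Sine and cosine determine the angle modulo `2π`, which suffices since the multiples `2k + 1`
    -- are integers.
    have hθ : ∀ c (k : Fin K), phaseVector θ c k = phaseVector φ c k := by
      have hs : Real.sin θ = Real.sin φ := by rw [hsθ, hsφ, h]
      have hc : Real.cos θ = Real.cos φ := by rw [hcθ, hcφ, h]
      have hang : (θ : Real.Angle) = φ := Real.Angle.cos_sin_inj hc hs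
      intro c k
      have h2 : (((2 * (k : ℕ) + 1 : ℕ) * θ : ℝ) : Real.Angle) = ((2 * (k : ℕ) + 1 : ℕ) * φ : ℝ) := by
        rw [← nsmul_eq_mul, ← nsmul_eq_mul, Real.Angle.coe_nsmul, Real.Angle.coe_nsmul, hang]
      push_cast at h2
      have h3 := congrArg Real.Angle.cos h2
      have h4 := congrArg Real.Angle.sin h2
      simp only [Real.Angle.cos_coe, Real.Angle.sin_coe] at h3 h4
      cases c <;> simp [phaseVector, h3, h4]
    have hself : ∀ c, (∑ k, e c k * phaseVector θ c k) ^ 2 =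
        ∑ k : Fin K, phaseVector φ c k ^ 2 := by
      intro c
      have : ∀ k, e c k * phaseVector θ c k =
          Real.sqrt (∑ k : Fin K, phaseVector φ c k ^ 2) * e c k ^ 2 := by
        intro k
        rw [hθ, hev c k]
        ring
      simp only [this]
      rw [← Finset.mul_sum, he, mul_one, Real.sq_sqrt (hN c)]
    rw [hself, hself, ← Finset.sum_add_distrib]
    simp [phaseVector, hK.ne']
  · intro r hr ha2 hKa hKr hra
    have hsum : ∀ x y : ℝ, x ≤ 1 / (2 * r) → y ≤ 1 / (2 * r) → (x + y) / 2 ≤ K / 10 := by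
      intro x y hx hy
      have : 1 / (2 * r) ≤ K / 10 := by
        rw [div_le_div_iff₀ (by positivity) (by norm_num)]
        linarith
      linarith
    have hs0 : 0 < Real.sin φ := by
      rw [hsφ]
      rcases (Real.sqrt_nonneg a₀).eq_or_lt' with h | h
      · rw [h] at hKa
        linarith
      · exact h
    have hsr : Real.sin φ + r ≤ Real.sin θ := by rw [hsφ, hsθ]; exact hra
    have hc0 : 0 ≤ Real.cos θ := hcθ ▸ Real.sqrt_nonneg _
    have hc0' : 0 ≤ Real.cos φ := hcφ ▸ Real.sqrt_nonneg _
    -- Each factor on the left is at most `sin θ + sin φ`, so the other is at least `sin θ - sin φ ≥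
    -- r`. This bounds both cosine sums in the inner products by `1 / (2 * r)`.
    have hmul : Real.sin (θ - φ) * Real.sin (θ + φ) =
        (Real.sin θ - Real.sin φ) * (Real.sin θ + Real.sin φ) := by
      rw [Real.sin_sub, Real.sin_add]
      linear_combination Real.sin θ ^ 2 * Real.sin_sq_add_cos_sq φ -
        Real.sin φ ^ 2 * Real.sin_sq_add_cos_sq θ
    have hle1 : Real.sin (θ + φ) ≤ Real.sin θ + Real.sin φ := by
      rw [Real.sin_add]
      nlinarith [Real.cos_le_one θ, Real.cos_le_one φ]
    have hpos : 0 < Real.sin (θ + φ) := by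
      rw [Real.sin_add]
      have : 0 < Real.cos φ := by
        rw [hcφ]
        exact Real.sqrt_pos.2 (by linarith)
      have : 0 < Real.sin θ * Real.cos φ := mul_pos (by linarith) this
      nlinarith
    have hle2 : Real.sin (θ - φ) ≤ Real.sin θ + Real.sin φ := by
      rw [Real.sin_sub]
      nlinarith [Real.cos_le_one θ, Real.cos_le_one φ]
    have hpos2 : 0 < Real.sin (θ - φ) := by
      have : 0 < (Real.sin θ - Real.sin φ) * (Real.sin θ + Real.sin φ) :=
        mul_pos (by linarith) (by linarith)
      rw [← hmul] at this
      exact pos_of_mul_pos_left this hpos.le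
    have hr1 : r ≤ Real.sin (θ - φ) := by
      have : (Real.sin θ - Real.sin φ) * (Real.sin θ + Real.sin φ) ≤
          Real.sin (θ - φ) * (Real.sin θ + Real.sin φ) :=
        hmul ▸ mul_le_mul_of_nonneg_left hle1 hpos2.le
      have := le_of_mul_le_mul_right this (by linarith)
      linarith
    have hr2 : r ≤ Real.sin (θ + φ) := by
      have : (Real.sin θ - Real.sin φ) * (Real.sin θ + Real.sin φ) ≤
          Real.sin (θ + φ) * (Real.sin θ + Real.sin φ) := by
        rw [← hmul, mul_comm]
        exact mul_le_mul_of_nonneg_left hle2 hpos.le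
      have := le_of_mul_le_mul_right this (by linarith)
      linarith
    have hA := abs_le.1 (Real.abs_sum_cos_le hr hr1 K)
    have hB := abs_le.1 (Real.abs_sum_cos_le hr hr2 K)
    have hinner : ∀ c, (∑ k : Fin K, phaseVector φ c k * phaseVector θ c k) ^ 2 ≤
        (K / 10 : ℝ) ^ 2 := by
      intro c
      rw [sum_phaseVector_mul]
      apply sq_le_sq'
      · cases c
        · simp only [Bool.false_eq_true, if_false]
          have := hsum _ _ (neg_le.1 hA.1) (neg_le.1 hB.1)
          linarith
        · simp only [if_true]
          have := hsum _ _ (neg_le.1 hA.1) hB.2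
          linarith
      · cases c
        · simp only [Bool.false_eq_true, if_false, one_mul]
          exact hsum _ _ hA.2 hB.2
        · simp only [if_true, neg_mul, one_mul]
          exact hsum _ _ hA.2 (neg_le.1 hB.1)
    -- Needed for the norms: the sums of squares differ from `K / 2` by half the cosine sum at `2φ`,
    -- hence by at most `K / 4`.
    have hsin2 : Real.sqrt a₀ ≤ Real.sin (φ + φ) := by
      rw [← two_mul, Real.sin_two_mul, hsφ, hcφ]
      have : 1 / 2 ≤ Real.sqrt (1 - a₀) := Real.le_sqrt_of_sq_le (by linarith)
      nlinarith [Real.sqrt_nonneg a₀]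
    have hC := abs_le.1 (Real.abs_sum_cos_le (hsφ ▸ hs0) hsin2 K)
    have hC' : 1 / (2 * Real.sqrt a₀) ≤ K / 2 := by
      rw [div_le_div_iff₀ (by linarith) (by norm_num)]
      linarith
    have hnorm : ∀ c, (K / 4 : ℝ) ≤ ∑ k : Fin K, phaseVector φ c k ^ 2 := by
      intro c
      have h2 : ∑ k : Fin K, phaseVector φ c k ^ 2 =
          ∑ k : Fin K, phaseVector φ c k * phaseVector φ c k := by simp only [sq]
      rw [h2, sum_phaseVector_mul]
      simp only [sub_self, mul_zero, Real.cos_zero, Finset.sum_const, Finset.card_univ,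
        Fintype.card_fin, nsmul_eq_mul, mul_one]
      cases c
      · simp only [Bool.false_eq_true, if_false]
        linarith
      · simp only [if_true]
        linarith
    have hfin : ∀ c, (∑ k, e c k * phaseVector θ c k) ^ 2 ≤ K / 25 := by
      intro c
      have h2 : (K / 4 : ℝ) * (∑ k, e c k * phaseVector θ c k) ^ 2 ≤ (K / 10 : ℝ) ^ 2 :=
        (mul_le_mul_of_nonneg_right (hnorm c) (sq_nonneg _)).trans ((hprod c).trans_le (hinner c))
      have h3 : (K / 4 : ℝ) * (∑ k, e c k * phaseVector θ c k) ^ 2 ≤ (K / 4) * (K / 25) := by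
        linarith
      exact le_of_mul_le_mul_left h3 (by linarith)
    rw [div_le_iff₀ hK]
    linarith [hfin false, hfin true]

end QueryAlgorithm

/-! ### Moments of sums over independent uniform samples -/

/-- The mean of `F` over `s` independent uniformly random elements of `[n]`. -/
noncomputable def sampleMean {n s : ℕ} (F : (Fin s → Fin n) → ℝ) : ℝ :=
  (∑ I, F I) / (n : ℝ) ^ s

section SampleMean

variable {n s : ℕ}

theorem sampleMean_add (F G : (Fin s → Fin n) → ℝ) :
    sampleMean (fun I => F I + G I) = sampleMean F + sampleMean G := by
  simp [sampleMean, Finset.sum_add_distrib, add_div]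

theorem sampleMean_const_mul (c : ℝ) (F : (Fin s → Fin n) → ℝ) :
    sampleMean (fun I => c * F I) = c * sampleMean F := by
  simp [sampleMean, ← Finset.mul_sum, mul_div_assoc]

theorem sampleMean_sum {ι : Type*} (t : Finset ι) (F : ι → (Fin s → Fin n) → ℝ) :
    sampleMean (fun I => ∑ i ∈ t, F i I) = ∑ i ∈ t, sampleMean (F i) := by
  simp only [sampleMean]
  rw [Finset.sum_comm, Finset.sum_div]

theorem sampleMean_mono {F G : (Fin s → Fin n) → ℝ} (h : ∀ I, F I ≤ G I) :
    sampleMean F ≤ sampleMean G :=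
  div_le_div_of_nonneg_right (Finset.sum_le_sum fun I _ => h I) (by positivity)

/-- Independence of the samples; the first and second moments below come from it by taking most
factors equal to `1`. -/
theorem sampleMean_prod (G : Fin s → Fin n → ℝ) :
    sampleMean (fun I => ∏ l, G l (I l)) = ∏ l, (∑ x, G l x) / n := by
  rw [Finset.prod_div_distrib, Finset.prod_univ_sum, sampleMean]
  simp

variable [NeZero n]

theorem sampleMean_const (c : ℝ) : sampleMean (n := n) (s := s) (fun _ => c) = c := by
  have hn : (n : ℝ) ≠ 0 := by exact_mod_cast NeZero.ne n
  simp [sampleMean]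
  field_simp

theorem sampleMean_apply (i : Fin s) (g : Fin n → ℝ) :
    sampleMean (fun I => g (I i)) = (∑ x, g x) / n := by
  have hn : (n : ℝ) ≠ 0 := by exact_mod_cast NeZero.ne n
  have h := sampleMean_prod fun l x => if l = i then g x else 1
  simp only [Finset.prod_ite_eq', Finset.mem_univ, if_true] at h
  rw [h, ← Fintype.prod_ite_eq' i fun _ => (∑ x, g x) / n]
  refine Finset.prod_congr rfl fun l _ => ?_
  by_cases hl : l = i <;> simp [hl, hn]

theorem sampleMean_apply_mul_apply {i k : Fin s} (hik : i ≠ k) (g h : Fin n → ℝ) :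
    sampleMean (fun I => g (I i) * h (I k)) = (∑ x, g x) / n * ((∑ x, h x) / n) := by
  have hn : (n : ℝ) ≠ 0 := by exact_mod_cast NeZero.ne n
  have h1 := sampleMean_prod fun l x => (if l = i then g x else 1) * (if l = k then h x else 1)
  simp only [Finset.prod_mul_distrib, Finset.prod_ite_eq', Finset.mem_univ, if_true] at h1
  rw [h1, ← Fintype.prod_ite_eq' i fun _ => (∑ x, g x) / n,
    ← Fintype.prod_ite_eq' k fun _ => (∑ x, h x) / n, ← Finset.prod_mul_distrib]
  refine Finset.prod_congr rfl fun l _ => ?_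
  by_cases hl : l = i
  · subst hl
    simp [hik]
  · by_cases hl' : l = k <;> simp [hl, hl', hn, hik.symm]

theorem sampleMean_sq_sum (g : Fin n → ℝ) :
    sampleMean (fun I : Fin s → Fin n => (∑ i, g (I i)) ^ 2) =
      s * ((∑ x, g x ^ 2) / n) + s * (s - 1) * ((∑ x, g x) / n) ^ 2 := by
  have h : ∀ i k : Fin s, sampleMean (fun I : Fin s → Fin n => g (I i) * g (I k)) =
      ((∑ x, g x) / n) ^ 2 +
        if i = k then (∑ x, g x ^ 2) / n - ((∑ x, g x) / n) ^ 2 else 0 := by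
    intro i k
    by_cases hik : i = k
    · subst hik
      simp only [← sq, if_true]
      rw [sampleMean_apply i fun x => g x ^ 2]
      ring
    · rw [sampleMean_apply_mul_apply hik, if_neg hik]
      ring
  simp only [sq (∑ i, g _), Finset.sum_mul_sum, sampleMean_sum, h]
  simp [Finset.sum_add_distrib]
  ring

theorem sampleMean_sum_apply (g : Fin n → ℝ) :
    sampleMean (fun I : Fin s → Fin n => ∑ i, g (I i)) = s * ((∑ x, g x) / n) := by
  simp [sampleMean_sum, sampleMean_apply]

end SampleMean

theorem sum_comp_div_eq_sum_inducedDist {n m : ℕ} (f : Fin n → Fin m) (φ : Fin m → ℝ) :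
    (∑ x, φ (f x)) / n = ∑ j, inducedDist f j * φ j := by
  rw [← Finset.sum_fiberwise Finset.univ f, Finset.sum_div]
  refine Finset.sum_congr rfl fun j _ => ?_
  rw [Finset.sum_congr rfl fun x hx => by rw [(Finset.mem_filter.1 hx).2], Finset.sum_const,
    nsmul_eq_mul, inducedDist]
  ring

theorem inducedDist_nonneg {n m : ℕ} (f : Fin n → Fin m) (j : Fin m) : 0 ≤ inducedDist f j := by
  unfold inducedDist
  positivity

theorem sum_inducedDist {n m : ℕ} [NeZero n] (f : Fin n → Fin m) : ∑ j, inducedDist f j = 1 := by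
  have hn : (n : ℝ) ≠ 0 := by exact_mod_cast NeZero.ne n
  have := sum_comp_div_eq_sum_inducedDist f fun _ => 1
  simp only [mul_one] at this
  rw [← this]
  simp [hn]

/-! ### The weights -/

/-- The number of samples with value `j`. -/
def valueCount {m s : ℕ} (v : Fin s → Fin m) (j : Fin m) : ℕ :=
  (Finset.univ.filter fun i => v i = j).card

theorem sum_valueCount_mul {m s : ℕ} (v : Fin s → Fin m) (φ : Fin m → ℝ) :
    ∑ j, (valueCount v j : ℝ) * φ j = ∑ i, φ (v i) := by
  rw [← Finset.sum_fiberwise Finset.univ v]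
  refine Finset.sum_congr rfl fun j _ => ?_
  rw [Finset.sum_congr rfl fun x hx => by rw [(Finset.mem_filter.1 hx).2], Finset.sum_const,
    nsmul_eq_mul, valueCount]

theorem valueCount_eq_sum {m s : ℕ} (v : Fin s → Fin m) (j : Fin m) :
    (valueCount v j : ℝ) = ∑ i, if v i = j then 1 else 0 := by
  simp [valueCount]

/-- The weight of the value `j` when the samples have the values `v`: up to normalization, the
number of samples with value `j` divided by `q j + 1 / m` and truncated, plus a term that does not
depend on the samples. -/
noncomputable def valueWeight {m s : ℕ} (M : ℝ) (q : Fin m → ℝ) (v : Fin s → Fin m)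
    (j : Fin m) : ℝ :=
  (s / M + s / (m * (M * (q j + 1 / m))) + min (valueCount v j / (M * (q j + 1 / m))) 1) / 3

/-- The truncated relative deviation of `p` from `q`. -/
noncomputable def truncatedDeviation {m : ℕ} (p q : Fin m → ℝ) (j : Fin m) : ℝ :=
  min ((p j - q j) / (q j + 1 / m)) 1

/-- A bound for the effect of the truncation of the weights. -/
noncomputable def truncationLoss {m s : ℕ} (M : ℝ) (p : Fin m → ℝ) (v : Fin s → Fin m) : ℝ :=
  ∑ j, 2 * ((valueCount v j : ℝ) ^ 2 - valueCount v j) / (M ^ 2 * (p j + 1 / m))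

theorem Nat.cast_sq_sub_self_nonneg (N : ℕ) : (0 : ℝ) ≤ (N : ℝ) ^ 2 - N := by
  rcases N.eq_zero_or_pos with rfl | h
  · simp
  · have : (1 : ℝ) ≤ N := by exact_mod_cast h
    nlinarith

/-- Here `d = p j - q j` and `t = q j + 1/m`. Truncating the weight can only hurt if `d > 0` and `N
> M * t`; then `N ≥ 2`, so the loss is at least `(N / M)^2 / (t + d)`. -/
theorem truncated_mul_le {d t M : ℝ} (ht : 0 < t) (hd : 0 < t + d) (hM : 0 < M) (hMt : 1 ≤ M * t)
    (N : ℕ) :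
    min (d / t) 1 * (N / M) - 2 * ((N : ℝ) ^ 2 - N) / (M ^ 2 * (t + d)) ≤
      d * min (N / (M * t)) 1 := by
  have hN := Nat.cast_sq_sub_self_nonneg N
  have hloss : 0 ≤ 2 * ((N : ℝ) ^ 2 - N) / (M ^ 2 * (t + d)) := by positivity
  have hNM : (0 : ℝ) ≤ N / M := by positivity
  have heq : d / t * (N / M) = d * (N / (M * t)) := by field_simp
  rcases le_total d 0 with h | h
  · have h1 : d / t * (N / M) ≤ d * min (N / (M * t)) 1 := by
      rw [heq]
      exact mul_le_mul_of_nonpos_left (min_le_left _ _) h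
    have h2 : min (d / t) 1 * (N / M) ≤ d / t * (N / M) :=
      mul_le_mul_of_nonneg_right (min_le_left _ _) hNM
    linarith
  rcases le_or_gt ((N : ℝ) / (M * t)) 1 with h1 | h1
  · rw [min_eq_left h1, ← heq]
    have h2 : min (d / t) 1 * (N / M) ≤ d / t * (N / M) :=
      mul_le_mul_of_nonneg_right (min_le_left _ _) hNM
    linarith
  · rw [min_eq_right h1.le, mul_one]
    have h2 : (1 : ℝ) < N := by
      rw [one_lt_div (by positivity)] at h1
      linarith
    have h3 : (2 : ℝ) ≤ N := by
      have : 1 < N := by exact_mod_cast h2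
      exact_mod_cast this
    set u := min (d / t) 1 with hu
    set y := (N : ℝ) / M with hy
    have hu0 : 0 ≤ u := le_min (by positivity) zero_le_one
    have hu1 : u ≤ 1 := min_le_right _ _
    have hut : u * t ≤ d := by
      rw [← le_div_iff₀ ht]
      exact min_le_left _ _
    have h4 : y ^ 2 / (t + d) ≤ 2 * ((N : ℝ) ^ 2 - N) / (M ^ 2 * (t + d)) := by
      rw [hy, div_pow, div_div]
      gcongr
      nlinarith
    have h5 : u * y - y ^ 2 / (t + d) ≤ d := by
      -- Completing the square in `y` leaves `u^2 * (t + d) / 4`, and `u ≤ 1`, `u * t ≤ d` make this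
      -- at most `d / 2`.
      rw [sub_le_iff_le_add, ← sub_le_iff_le_add', le_div_iff₀ hd]
      have h6 : u ^ 2 * (t + d) ≤ 2 * d := by
        have h7 : u * (u * t) ≤ 1 * d := mul_le_mul hu1 hut (by positivity) zero_le_one
        have h8 : u ^ 2 * d ≤ 1 * d := mul_le_mul_of_nonneg_right (by nlinarith) h
        linarith
      nlinarith [sq_nonneg (y - u * (t + d) / 2)]
    linarith

section Weights

variable {m s : ℕ} {M : ℝ} {p q : Fin m → ℝ} {v : Fin s → Fin m}

theorem one_le_mul_add [NeZero m] (hM : (m : ℝ) ≤ M) {x : ℝ} (hx : 0 ≤ x) :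
    1 ≤ M * (x + 1 / m) := by
  have hm : (0 : ℝ) < m := by exact_mod_cast NeZero.pos m
  have h : (m : ℝ) * (1 / m) = 1 := by field_simp
  have h1 : 0 < 1 / (m : ℝ) := by positivity
  nlinarith

/-- The constant term `s / M` gives the lower bound, which keeps the reference angle of the
amplitude test away from `0`. All three terms are at most `1`, whence the division by `3`. -/
theorem valueWeight_mem [NeZero m] (hM : (m : ℝ) ≤ M) (hs : (s : ℝ) ≤ M) (hq : ∀ j, 0 ≤ q j)
    (j : Fin m) : s / (3 * M) ≤ valueWeight M q v j ∧ valueWeight M q v j ≤ 1 := by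
  have hm : (0 : ℝ) < m := by exact_mod_cast NeZero.pos m
  have hM0 : 0 < M := hm.trans_le hM
  have hc := one_le_mul_add hM (hq j)
  have h1 : 0 ≤ min (valueCount v j / (M * (q j + 1 / m))) 1 := by positivity
  have h2 : min (valueCount v j / (M * (q j + 1 / m))) 1 ≤ 1 := min_le_right _ _
  have h3 : 0 ≤ s / (m * (M * (q j + 1 / m))) := by positivity
  have h4 : (s : ℝ) / M ≤ 1 := (div_le_one hM0).2 hs
  have h5 : s / (m * (M * (q j + 1 / m))) ≤ 1 := by
    rw [div_le_one (by positivity)]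
    have : m * (M * (q j + 1 / m)) = M + M * m * q j := by field_simp; ring
    rw [this]
    have := mul_nonneg (mul_nonneg hM0.le hm.le) (hq j)
    linarith
  have h6 : (s : ℝ) / (3 * M) = s / M / 3 := by rw [div_div, mul_comm]
  unfold valueWeight
  constructor <;> linarith

/-- Since `q j / (q j + 1/m) ≤ 1`, each of the three terms contributes at most `s / (3 * M)`. This
holds for every sample, not merely on average. -/
theorem sum_mul_valueWeight_le [NeZero m] (hM : (m : ℝ) ≤ M) (hq : ∀ j, 0 ≤ q j)
    (hq1 : ∑ j, q j = 1) : ∑ j, q j * valueWeight M q v j ≤ s / M := by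
  have hm : (0 : ℝ) < m := by exact_mod_cast NeZero.pos m
  have hM0 : 0 < M := hm.trans_le hM
  have h : ∀ j, q j * valueWeight M q v j ≤
      (q j * (s / M) + (s / M) * (1 / m) + (1 / M) * (valueCount v j * 1)) / 3 := by
    intro j
    have hc := one_le_mul_add hM (hq j)
    have hqc : q j / (M * (q j + 1 / m)) ≤ 1 / M := by
      have : 0 < 1 / (m : ℝ) := by positivity
      have := hq j
      rw [div_le_div_iff₀ (by positivity) hM0]
      nlinarith
    have h1 : q j * (s / (m * (M * (q j + 1 / m)))) ≤ (s / M) * (1 / m) := by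
      calc q j * (s / (m * (M * (q j + 1 / m)))) = (s * (1 / m)) * (q j / (M * (q j + 1 / m))) := by
            field_simp
        _ ≤ (s * (1 / m)) * (1 / M) := by gcongr
        _ = _ := by ring
    have h2 : q j * min (valueCount v j / (M * (q j + 1 / m))) 1 ≤
        (1 / M) * (valueCount v j * 1) := by
      calc q j * min (valueCount v j / (M * (q j + 1 / m))) 1
          ≤ q j * (valueCount v j / (M * (q j + 1 / m))) :=
            mul_le_mul_of_nonneg_left (min_le_left _ _) (hq j)
        _ = valueCount v j * (q j / (M * (q j + 1 / m))) := by ring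
        _ ≤ valueCount v j * (1 / M) := by gcongr
        _ = _ := by ring
    unfold valueWeight
    linarith
  refine (Finset.sum_le_sum fun j _ => h j).trans_eq ?_
  rw [← Finset.sum_div, Finset.sum_add_distrib, Finset.sum_add_distrib, ← Finset.sum_mul, hq1,
    ← Finset.mul_sum (a := 1 / M), sum_valueCount_mul v fun _ => 1]
  simp
  field_simp
  ring

/-- The constant term of the weight cancels because the totals agree. The other sample-independent
term provides the uniform part of a mean with respect to `p j + 1/m`, the counts an empirical
version of the `p` part. -/
theorem le_sum_sub_mul_valueWeight [NeZero m] (hM : (m : ℝ) ≤ M) (hp : ∀ j, 0 ≤ p j)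
    (hq : ∀ j, 0 ≤ q j) (hpq : ∑ j, p j = ∑ j, q j) :
    ((∑ i, truncatedDeviation p q (v i) + s * ∑ j, 1 / m * truncatedDeviation p q j) / M -
      truncationLoss M p v) / 3 ≤ ∑ j, p j * valueWeight M q v j - ∑ j, q j * valueWeight M q v j := by
  have hm : (0 : ℝ) < m := by exact_mod_cast NeZero.pos m
  have hM0 : 0 < M := hm.trans_le hM
  have hm' : 0 < 1 / (m : ℝ) := by positivity
  have h : ∀ j, ((valueCount v j * truncatedDeviation p q j +
      s * (1 / m * truncatedDeviation p q j)) / M -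
      2 * ((valueCount v j : ℝ) ^ 2 - valueCount v j) / (M ^ 2 * (p j + 1 / m))) / 3 +
        (p j - q j) * (s / M / 3) ≤ p j * valueWeight M q v j - q j * valueWeight M q v j := by
    intro j
    have hq' := hq j
    have hp' := hp j
    have h1 := truncated_mul_le (d := p j - q j) (t := q j + 1 / m) (M := M) (by positivity)
      (by linarith) hM0 (one_le_mul_add hM (hq j)) (valueCount v j)
    rw [show q j + 1 / (m : ℝ) + (p j - q j) = p j + 1 / m by ring] at h1
    have h2 : s * (1 / m * truncatedDeviation p q j) / M ≤
        (p j - q j) * (s / (m * (M * (q j + 1 / m)))) := by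
      have h3 : truncatedDeviation p q j ≤ (p j - q j) / (q j + 1 / m) := min_le_left _ _
      calc s * (1 / m * truncatedDeviation p q j) / M
          ≤ s * (1 / m * ((p j - q j) / (q j + 1 / m))) / M := by gcongr
        _ = _ := by
          have : q j + 1 / (m : ℝ) ≠ 0 := by positivity
          rw [← sub_eq_zero]
          field_simp
          ring
    have h4 : valueCount v j * truncatedDeviation p q j / M =
        min ((p j - q j) / (q j + 1 / m)) 1 * (valueCount v j / M) := by
      unfold truncatedDeviation
      ring
    unfold valueWeight
    rw [add_div, h4]
    linarith
  have h5 := Finset.sum_le_sum fun j (_ : j ∈ Finset.univ) => h j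
  rw [Finset.sum_sub_distrib, Finset.sum_add_distrib, ← Finset.sum_div, Finset.sum_sub_distrib,
    ← Finset.sum_div, Finset.sum_add_distrib, ← Finset.sum_mul, Finset.sum_sub_distrib, hpq,
    sum_valueCount_mul, ← Finset.mul_sum (a := (s : ℝ))] at h5
  simpa [truncationLoss] using h5

/-- Without truncation the summand is `d^2 / t + d`, with `d = p j - q j` and `t = q j + 1/m`, and
the `d` sum to zero. Truncation does not affect `d < 0`, and the negative parts have total at least
`ε / 2`; Cauchy–Schwarz against the total mass `2` of `t` gives `(ε / 2)^2 / 2`. -/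
theorem sq_div_eight_le_sum_truncatedDeviation [NeZero m] (hp : ∀ j, 0 ≤ p j)
    (hq : ∀ j, 0 ≤ q j) (hp1 : ∑ j, p j = 1) (hq1 : ∑ j, q j = 1) {ε : ℝ} (hε : 0 ≤ ε)
    (hpq : ε ≤ l1Dist p q) :
    ε ^ 2 / 8 ≤ ∑ j, (p j + 1 / m) * truncatedDeviation p q j := by
  have hm : (0 : ℝ) < m := by exact_mod_cast NeZero.pos m
  have hm' : 0 < 1 / (m : ℝ) := by positivity
  have hmass : ∑ j, (q j + 1 / m) = 2 := by
    rw [Finset.sum_add_distrib, hq1]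
    simp [hm.ne']
    norm_num
  have hneg : ∑ j, max (q j - p j) 0 = l1Dist p q / 2 := by
    have h : ∀ j, max (q j - p j) 0 = (|p j - q j| + (q j - p j)) / 2 := by
      intro j
      rcases le_total (q j - p j) 0 with h | h
      · rw [max_eq_right h, abs_of_nonneg (by linarith)]
        ring
      · rw [max_eq_left h, abs_of_nonpos (by linarith)]
        ring
    simp only [h]
    rw [← Finset.sum_div, Finset.sum_add_distrib, Finset.sum_sub_distrib, hp1, hq1, l1Dist]
    ring
  have hcs := Finset.sum_sq_le_sum_mul_sum_of_sq_le_mul Finset.univ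
    (r := fun j => max (q j - p j) 0) (f := fun j => q j + 1 / m)
    (g := fun j => max (q j - p j) 0 ^ 2 / (q j + 1 / m))
    (fun j _ => by have := hq j; positivity) (fun j _ => by have := hq j; positivity)
    (fun j _ => by
      have : q j + 1 / (m : ℝ) ≠ 0 := by have := hq j; positivity
      exact (mul_div_cancel₀ _ this).ge)
  rw [hneg, hmass] at hcs
  have hterm : ∀ j, max (q j - p j) 0 ^ 2 / (q j + 1 / m) + (p j - q j) ≤
      (p j + 1 / m) * truncatedDeviation p q j := by
    intro j
    have ht : 0 < q j + 1 / (m : ℝ) := by have := hq j; positivity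
    set t := q j + 1 / (m : ℝ) with htd
    have hpt : p j + 1 / (m : ℝ) = t + (p j - q j) := by rw [htd]; ring
    have hqp : q j - p j = -(p j - q j) := by ring
    have hd : 0 < t + (p j - q j) := by rw [← hpt]; have := hp j; positivity
    unfold truncatedDeviation
    rw [hpt, ← htd, hqp]
    set d := p j - q j
    rcases le_total (d / t) 1 with h | h
    · rw [min_eq_left h]
      have h1 : max (-d) 0 ^ 2 ≤ d ^ 2 := by
        rcases le_total (-d) 0 with h2 | h2
        · rw [max_eq_right h2]
          nlinarith
        · rw [max_eq_left h2]
          nlinarith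
      have h2 : (t + d) * (d / t) = d ^ 2 / t + d := by
        field_simp
        ring
      rw [h2]
      gcongr
    · rw [min_eq_right h]
      have h2 : t ≤ d := (one_le_div ht).1 h
      rw [max_eq_right (by linarith)]
      simp
      linarith
  have hsum := Finset.sum_le_sum fun j (_ : j ∈ Finset.univ) => hterm j
  rw [Finset.sum_add_distrib, Finset.sum_sub_distrib, hp1, hq1] at hsum
  nlinarith

theorem abs_truncatedDeviation_le [NeZero m] (hp : ∀ j, 0 ≤ p j) (hq : ∀ j, 0 ≤ q j)
    (j : Fin m) : |truncatedDeviation p q j| ≤ 1 := by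
  have hm : (0 : ℝ) < m := by exact_mod_cast NeZero.pos m
  have ht : 0 < q j + 1 / (m : ℝ) := by have := hq j; positivity
  rw [abs_le]
  refine ⟨le_min ?_ (by norm_num), min_le_right _ _⟩
  rw [le_div_iff₀ ht]
  have : 0 < 1 / (m : ℝ) := by positivity
  linarith [hp j]

end Weights

/-! ### Expected truncation loss and variance -/

section SampledMoments

variable {n m s : ℕ} [NeZero n]

/-- The mean of `N^2 - N` is `s * (s - 1) * p j^2`, and one factor `p j` is absorbed by the
denominator `p j + 1/m`. -/
theorem sampleMean_truncationLoss_le [NeZero m] {M : ℝ} (hM : 0 < M) (f : Fin n → Fin m) :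
    sampleMean (fun I : Fin s → Fin n => truncationLoss M (inducedDist f) (f ∘ I)) ≤
      2 * s ^ 2 / M ^ 2 := by
  have hm : (0 : ℝ) < m := by exact_mod_cast NeZero.pos m
  have hm' : 0 < 1 / (m : ℝ) := by positivity
  have h : ∀ j, sampleMean (fun I : Fin s → Fin n =>
      2 * ((valueCount (f ∘ I) j : ℝ) ^ 2 - valueCount (f ∘ I) j) /
        (M ^ 2 * (inducedDist f j + 1 / m))) ≤ 2 * s ^ 2 / M ^ 2 * inducedDist f j := by
    intro j
    have hp := inducedDist_nonneg f j
    have hmean : (∑ x, if f x = j then (1 : ℝ) else 0) / n = inducedDist f j := by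
      simp [inducedDist]
    have hsq := sampleMean_sq_sum (s := s) fun x => if f x = j then (1 : ℝ) else 0
    have hlin := sampleMean_sum_apply (s := s) fun x => if f x = j then (1 : ℝ) else 0
    simp only [ite_pow, one_pow, zero_pow two_ne_zero, hmean] at hsq hlin
    have h1 : (fun I : Fin s → Fin n =>
        2 * ((valueCount (f ∘ I) j : ℝ) ^ 2 - valueCount (f ∘ I) j) /
          (M ^ 2 * (inducedDist f j + 1 / m))) = fun I =>
        2 / (M ^ 2 * (inducedDist f j + 1 / m)) *
          ((∑ i, if f (I i) = j then (1 : ℝ) else 0) ^ 2 +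
            (-1) * ∑ i, if f (I i) = j then (1 : ℝ) else 0) := by
      funext I
      simp only [valueCount_eq_sum, Function.comp_apply]
      ring
    rw [h1, sampleMean_const_mul, sampleMean_add, sampleMean_const_mul, hsq, hlin]
    set x := inducedDist f j
    have h2 : s * x + s * (s - 1) * x ^ 2 + -1 * (s * x) ≤ s ^ 2 * (x * (x + 1 / m)) := by
      have : 0 ≤ (s : ℝ) ^ 2 * (x * (1 / m)) := by positivity
      have : 0 ≤ (s : ℝ) * x ^ 2 := by positivity
      nlinarith
    calc 2 / (M ^ 2 * (x + 1 / m)) * (s * x + s * (s - 1) * x ^ 2 + -1 * (s * x))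
        ≤ 2 / (M ^ 2 * (x + 1 / m)) * (s ^ 2 * (x * (x + 1 / m))) := by gcongr
      _ = _ := by
        have hx : x + 1 / (m : ℝ) ≠ 0 := by positivity
        generalize x + 1 / (m : ℝ) = z at hx
        field_simp
  unfold truncationLoss
  rw [sampleMean_sum]
  refine (Finset.sum_le_sum fun j _ => h j).trans_eq ?_
  rw [← Finset.mul_sum, sum_inducedDist, mul_one]

theorem sampleMean_sq_deviation_le (f : Fin n → Fin m) {φ : Fin m → ℝ} (hφ : ∀ j, |φ j| ≤ 1) :
    sampleMean (fun I : Fin s → Fin n =>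
      (∑ i, φ (f (I i)) - s * ∑ j, inducedDist f j * φ j) ^ 2) ≤ s := by
  have hn : (0 : ℝ) < n := by exact_mod_cast NeZero.pos n
  set μ := ∑ j, inducedDist f j * φ j with hμ
  have hμ' : (∑ x, φ (f x)) / n = μ := sum_comp_div_eq_sum_inducedDist f φ
  have hsq := sampleMean_sq_sum (s := s) fun x => φ (f x) - μ
  have hzero : (∑ x, (φ (f x) - μ)) / n = 0 := by
    rw [Finset.sum_sub_distrib, sub_div, hμ']
    simp [hn.ne']
  have hvar : (∑ x, (φ (f x) - μ) ^ 2) / n ≤ 1 := by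
    have h1 : ∑ x, (φ (f x) - μ) ^ 2 = ∑ x, φ (f x) ^ 2 - n * μ ^ 2 := by
      have h2 : ∑ x, φ (f x) = n * μ := by rw [← hμ']; field_simp
      have h3 : ∀ x, (φ (f x) - μ) ^ 2 = φ (f x) ^ 2 - 2 * μ * φ (f x) + μ ^ 2 := fun x => by ring
      simp only [h3]
      rw [Finset.sum_add_distrib, Finset.sum_sub_distrib, ← Finset.mul_sum, h2]
      simp
      ring
    have h4 : ∑ x, φ (f x) ^ 2 ≤ n := by
      have := Finset.sum_le_sum fun (x : Fin n) (_ : x ∈ Finset.univ) =>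
        (sq_le_one_iff_abs_le_one (φ (f x))).2 (hφ (f x))
      simpa using this
    rw [div_le_one hn, h1]
    have : 0 ≤ (n : ℝ) * μ ^ 2 := by positivity
    linarith
  have hrw : ∀ I : Fin s → Fin n, ∑ i, (φ (f (I i)) - μ) = ∑ i, φ (f (I i)) - s * μ := by
    intro I
    simp
  simp only [hrw, hzero] at hsq
  rw [hsq]
  have := mul_le_mul_of_nonneg_left hvar (Nat.cast_nonneg (α := ℝ) s)
  linarith

end SampledMoments

/-! ### The closeness tester -/

namespace QueryAlgorithm.Realizes

variable {n m : ℕ} [NeZero n] [NeZero m]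

/-- Queries at `s` independent uniformly random points, followed by an algorithm that depends on
the answers. -/
theorem exists_sampleMean {W : Type} [Fintype W] [DecidableEq W] [Nonempty W] {q : ℕ} (s : ℕ)
    {ι : Type} (P : ι → (Fin s → Fin m) → (Fin n → Fin m) → ℝ)
    (hP : ∀ i v, Realizes W q (P i v)) :
    ∃ (W' : Type) (_ : Fintype W') (_ : DecidableEq W') (_ : Nonempty W'),
      ∀ i, Realizes W' (q + s) fun f => sampleMean fun I : Fin s → Fin n => P i (f ∘ I) f := by
  induction s generalizing ι with
  | zero =>
    refine ⟨W, inferInstance, inferInstance, inferInstance, fun i => ?_⟩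
    have h : ∀ f : Fin n → Fin m,
        sampleMean (fun I : Fin 0 → Fin n => P i (f ∘ I) f) = P i Fin.elim0 f := by
      intro f
      have : ∀ I : Fin 0 → Fin n, f ∘ I = Fin.elim0 := fun I => Subsingleton.elim _ _
      simp only [this, sampleMean_const]
    simp only [h]
    exact hP i _
  | succ s ih =>
    -- The value of the first sample joins the index, so that one workspace serves all its possible
    -- values.
    obtain ⟨W', _, _, _, h⟩ := ih (fun (p : ι × Fin m) v => P p.1 (Fin.cons p.2 v))
      fun p v => hP _ _
    refine ⟨Fin n × (BitVec (Nat.clog 2 m) × W'), inferInstance, inferInstance, inferInstance,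
      fun i => ?_⟩
    have h' := sample fun j => h (i, j)
    have hrw : ∀ f : Fin n → Fin m,
        sampleMean (fun I : Fin (s + 1) → Fin n => P i (f ∘ I) f) =
          (∑ x, sampleMean fun I : Fin s → Fin n => P i (Fin.cons (f x) (f ∘ I)) f) / n := by
      intro f
      simp only [sampleMean]
      rw [← Finset.sum_div, div_div, ← pow_succ, ← (Fin.consEquiv fun _ => Fin n).sum_comp,
        Fintype.sum_prod_type]
      congr 1
      refine Finset.sum_congr rfl fun x _ => Finset.sum_congr rfl fun I _ => ?_
      congr 1
      funext k
      refine Fin.cases ?_ (fun k => ?_) k <;> simp [Fin.consEquiv]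
    simp only [hrw]
    exact h'

end QueryAlgorithm.Realizes

namespace QueryAlgorithm

variable {n m : ℕ}

/-- A function on `[m]` as a function of bit strings. -/
noncomputable def extendWeight (w : Fin m → ℝ) (b : BitVec (Nat.clog 2 m)) : ℝ :=
  if h : b.toNat < m then w ⟨b.toNat, h⟩ else 0

theorem meanWeight_extendWeight (w : Fin m → ℝ) (f : Fin n → Fin m) :
    meanWeight (extendWeight w) f = ∑ j, inducedDist f j * w j := by
  rw [← sum_comp_div_eq_sum_inducedDist, meanWeight]
  congr 1
  refine Finset.sum_congr rfl fun x _ => ?_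
  have h : (BitVec.ofNat (Nat.clog 2 m) (f x : ℕ)).toNat < m :=
    (toNat_ofNat_clog (f x)).trans_lt (f x).2
  rw [extendWeight, dif_pos h]
  exact congrArg w (Fin.ext (toNat_ofNat_clog (f x)))

/-- For a sample whose deviation and truncation loss are small, the mean weights differ. -/
theorem add_le_sum_mul_valueWeight [NeZero n] [NeZero m] {ε M : ℝ} (hε : 0 ≤ ε) {s : ℕ}
    (hM : (m : ℝ) ≤ M) (f g : Fin n → Fin m)
    (hfg : ε ≤ l1Dist (inducedDist f) (inducedDist g)) (I : Fin s → Fin n)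
    (hdev : |∑ i, truncatedDeviation (inducedDist f) (inducedDist g) (f (I i)) -
      s * ∑ j, inducedDist f j * truncatedDeviation (inducedDist f) (inducedDist g) j| ≤
        s * ε ^ 2 / 32)
    (hloss : truncationLoss M (inducedDist f) (f ∘ I) ≤ s / M * (ε ^ 2 / 32)) :
    ∑ j, inducedDist g j * valueWeight M (inducedDist g) (f ∘ I) j + s / M * (ε ^ 2 / 48) ≤
      ∑ j, inducedDist f j * valueWeight M (inducedDist g) (f ∘ I) j := by
  have hm : (0 : ℝ) < m := by exact_mod_cast NeZero.pos m
  have hM0 : 0 < M := hm.trans_le hM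
  have h1 := le_sum_sub_mul_valueWeight (v := f ∘ I) hM (inducedDist_nonneg f)
    (inducedDist_nonneg g) ((sum_inducedDist f).trans (sum_inducedDist g).symm)
  have h2 := sq_div_eight_le_sum_truncatedDeviation (inducedDist_nonneg f) (inducedDist_nonneg g)
    (sum_inducedDist f) (sum_inducedDist g) hε hfg
  simp only [add_mul, Finset.sum_add_distrib] at h2
  have h3 := (abs_le.1 hdev).1
  -- The deviation reduces `1/8` to `3/32`; the loss leaves `1/16`, and the factor `1/3` of the
  -- weights gives `1/48`.
  have h4 : (s : ℝ) * (ε ^ 2 * (3 / 32)) ≤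
      ∑ i, truncatedDeviation (inducedDist f) (inducedDist g) ((f ∘ I) i) +
        s * ∑ j, 1 / (m : ℝ) * truncatedDeviation (inducedDist f) (inducedDist g) j := by
    have := mul_le_mul_of_nonneg_left h2 (Nat.cast_nonneg (α := ℝ) s)
    simp only [Function.comp_apply]
    linarith
  have h5 := div_le_div_of_nonneg_right h4 hM0.le
  have h6 : (s : ℝ) * (ε ^ 2 * (3 / 32)) / M = s / M * ε ^ 2 * (3 / 32) := by ring
  linarith

/-- Closeness testing with `s` classical samples and `2 * K + 1` further queries. -/
theorem exists_tests [NeZero n] [NeZero m] {ε M : ℝ} (hε : 0 < ε) (hε2 : ε ≤ 2)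
    (g : Fin n → Fin m) (s K : ℕ) [NeZero K] (hM : (m : ℝ) ≤ M) (hMs : 640 * s ≤ M * ε ^ 2)
    (hs : 10240 ≤ s * ε ^ 4) (hK : 720 ≤ K * (ε ^ 2 * Real.sqrt (s / M))) :
    ∃ A : QueryAlgorithm n m, A.queries = 2 * K + 1 + s ∧ A.Tests ε g := by
  have hm : (0 : ℝ) < m := by exact_mod_cast NeZero.pos m
  have hM0 : 0 < M := hm.trans_le hM
  have hε4 : ε ^ 2 ≤ 4 := by nlinarith
  have hs0 : (0 : ℝ) < s := by
    have : 0 < ε ^ 4 := by positivity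
    exact pos_of_mul_pos_left (by linarith) this.le
  have hsM : 160 * s ≤ M := by nlinarith
  set σ : ℝ := s / M with hσ
  have hσ0 : 0 < σ := by positivity
  have hσ1 : σ ≤ 1 / 2 := by
    rw [hσ, div_le_div_iff₀ hM0 (by norm_num)]
    linarith
  set q := inducedDist g with hq
  let w : (Fin s → Fin m) → BitVec (Nat.clog 2 m) → ℝ := fun v => extendWeight (valueWeight M q v)
  have hw : ∀ v b, 0 ≤ w v b ∧ w v b ≤ 1 := by
    intro v b
    by_cases h : b.toNat < m
    · have := valueWeight_mem (v := v) hM (by linarith) (inducedDist_nonneg g) ⟨b.toNat, h⟩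
      have h0 : 0 ≤ (s : ℝ) / (3 * M) := by positivity
      simp only [w, extendWeight, dif_pos h]
      exact ⟨h0.trans this.1, this.2⟩
    · simp [w, extendWeight, h]
  let a₀ : (Fin s → Fin m) → ℝ := fun v => ∑ j, q j * valueWeight M q v j
  have ha₀le : ∀ v, a₀ v ≤ σ := fun v =>
    sum_mul_valueWeight_le hM (inducedDist_nonneg g) (sum_inducedDist g)
  have hlea₀ : ∀ v, σ / 3 ≤ a₀ v := by
    intro v
    have := Finset.sum_le_sum fun (j : Fin m) (_ : j ∈ Finset.univ) =>
      mul_le_mul_of_nonneg_left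
        (valueWeight_mem (v := v) hM (by linarith) (inducedDist_nonneg g) j).1
        (inducedDist_nonneg g j)
    rw [← Finset.sum_mul, sum_inducedDist, one_mul] at this
    calc σ / 3 = s / (3 * M) := by rw [hσ, div_div, mul_comm]
      _ ≤ _ := this
  choose P hPr hP using fun v => exists_meanWeight_test (n := n) (m := m)
    (fun b => (hw v b).1) (fun b => (hw v b).2) K (a₀ := a₀ v)
    (by linarith [hlea₀ v]) (by linarith [ha₀le v])
  obtain ⟨W, _, _, _, hW⟩ := Realizes.exists_sampleMean s (fun _ : Unit => P) fun _ => hPr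
  obtain ⟨A, hAq, hAP⟩ := (hW ()).exists_queryAlgorithm
  refine ⟨A, hAq, fun f => ⟨fun h => ?_, fun h => ?_⟩⟩
  · have h1 : ∀ v, P v f = 1 := by
      intro v
      refine (hP v f).1 ?_
      rw [meanWeight_extendWeight, h]
    rw [hAP]
    simp only [h1, sampleMean_const]
    norm_num
  · set p := inducedDist f with hp
    set Z : (Fin s → Fin n) → ℝ := fun I =>
      ∑ i, truncatedDeviation p q (f (I i)) - s * ∑ j, p j * truncatedDeviation p q j with hZ
    set L : (Fin s → Fin n) → ℝ := fun I => truncationLoss M p (f ∘ I) with hL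
    have hL0 : ∀ I, 0 ≤ L I := fun I => Finset.sum_nonneg fun j _ => by
      have := Nat.cast_sq_sub_self_nonneg (valueCount (f ∘ I) j)
      have := inducedDist_nonneg f j
      positivity
    -- Chebyshev and Markov in one inequality: for a bad sample one of the last two terms is at
    -- least `1`; for a good one the test errs with probability at most `2/25`.
    have hbound : ∀ I, P (f ∘ I) f ≤
        2 / 25 + (1024 / (s ^ 2 * ε ^ 4) * Z I ^ 2 + 32 / (σ * ε ^ 2) * L I) := by
      intro I
      have hZ0 : 0 ≤ 1024 / (s ^ 2 * ε ^ 4) * Z I ^ 2 := by positivity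
      have hL0' : 0 ≤ 32 / (σ * ε ^ 2) * L I := mul_nonneg (by positivity) (hL0 I)
      have hP1 := (hPr (f ∘ I)).le_one f
      by_cases hdev : |Z I| ≤ s * ε ^ 2 / 32
      swap
      · have h1 : (s * ε ^ 2 / 32) ^ 2 ≤ Z I ^ 2 :=
          sq_le_sq.2 (by rw [abs_of_nonneg (by positivity)]; exact (not_le.1 hdev).le)
        have h2 : 1 ≤ 1024 / (s ^ 2 * ε ^ 4) * Z I ^ 2 := by
          rw [div_mul_eq_mul_div, one_le_div (by positivity)]
          linarith
        linarith
      by_cases hloss : L I ≤ σ * (ε ^ 2 / 32)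
      swap
      · have h2 : 1 ≤ 32 / (σ * ε ^ 2) * L I := by
          rw [div_mul_eq_mul_div, one_le_div (by positivity)]
          linarith
        linarith
      have hgap := add_le_sum_mul_valueWeight hε.le hM f g h I hdev hloss
      have hsq : Real.sqrt σ ^ 2 = σ := Real.sq_sqrt hσ0.le
      have hroot := Real.sqrt_pos.2 hσ0
      -- This `r` turns `5 ≤ K * r` into the hypothesis with `720`. As `a₀ ≤ σ` and `ε ≤ 2`,
      -- squaring `√a₀ + r` adds at most `σ * ε^2 * (1/72 + 1/5184)`, below the gap `σ * ε^2 / 48`.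
      have htest := (hP (f ∘ I) f).2 (Real.sqrt σ * ε ^ 2 / 144) (by positivity)
        ((ha₀le _).trans hσ1) ?_ ?_ ?_
      · linarith
      · have h1 : Real.sqrt σ / 2 ≤ Real.sqrt (a₀ (f ∘ I)) := by
          refine Real.le_sqrt_of_sq_le ?_
          rw [div_pow, hsq]
          linarith [hlea₀ (f ∘ I)]
        have h2 : (K : ℝ) * (ε ^ 2 * Real.sqrt σ) ≤ K * (4 * Real.sqrt σ) := by gcongr
        have h3 := mul_le_mul_of_nonneg_left h1 (Nat.cast_nonneg (α := ℝ) K)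
        linarith
      · linarith
      · have h0 : 0 ≤ a₀ (f ∘ I) := by linarith [hlea₀ (f ∘ I)]
        refine Real.le_sqrt_of_sq_le ?_
        rw [meanWeight_extendWeight]
        refine le_trans ?_ hgap
        have h1 : Real.sqrt (a₀ (f ∘ I)) ≤ Real.sqrt σ := Real.sqrt_le_sqrt (ha₀le _)
        have h2 : (Real.sqrt (a₀ (f ∘ I)) + Real.sqrt σ * ε ^ 2 / 144) ^ 2 =
            a₀ (f ∘ I) + Real.sqrt (a₀ (f ∘ I)) * (Real.sqrt σ * ε ^ 2 / 72) +
              σ * ε ^ 2 * (ε ^ 2 / 20736) := by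
          linear_combination Real.sq_sqrt h0 + ε ^ 4 / 20736 * hsq
        have h3 : Real.sqrt (a₀ (f ∘ I)) * (Real.sqrt σ * ε ^ 2 / 72) ≤
            Real.sqrt σ * (Real.sqrt σ * ε ^ 2 / 72) := by gcongr
        have h4 : Real.sqrt σ * (Real.sqrt σ * ε ^ 2 / 72) = σ * ε ^ 2 / 72 := by
          linear_combination ε ^ 2 / 72 * hsq
        have h5 : σ * ε ^ 2 * (ε ^ 2 / 20736) ≤ σ * ε ^ 2 * (4 / 20736) := by gcongr
        have h6 : 0 ≤ σ * ε ^ 2 := by positivity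
        rw [h2]
        change a₀ (f ∘ I) + _ + _ ≤ a₀ (f ∘ I) + _
        linarith
    have hmean := sampleMean_mono hbound
    rw [sampleMean_add, sampleMean_add, sampleMean_const_mul, sampleMean_const_mul,
      sampleMean_const] at hmean
    have hZm : sampleMean (fun I => Z I ^ 2) ≤ s := sampleMean_sq_deviation_le f
      (abs_truncatedDeviation_le (inducedDist_nonneg f) (inducedDist_nonneg g))
    have hLm : sampleMean L ≤ 2 * s ^ 2 / M ^ 2 := sampleMean_truncationLoss_le hM0 f
    have h1 : 1024 / (s ^ 2 * ε ^ 4) * sampleMean (fun I => Z I ^ 2) ≤ 1 / 10 := by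
      calc 1024 / (s ^ 2 * ε ^ 4) * sampleMean (fun I => Z I ^ 2)
          ≤ 1024 / (s ^ 2 * ε ^ 4) * s := by gcongr
        _ = 1024 / (s * ε ^ 4) := by field_simp
        _ ≤ 1 / 10 := by
          rw [div_le_div_iff₀ (by positivity) (by norm_num)]
          linarith
    have h2 : 32 / (σ * ε ^ 2) * sampleMean L ≤ 1 / 10 := by
      calc 32 / (σ * ε ^ 2) * sampleMean L
          ≤ 32 / (σ * ε ^ 2) * (2 * s ^ 2 / M ^ 2) := by gcongr
        _ = 64 * s / (M * ε ^ 2) := by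
          rw [hσ]
          field_simp
          norm_num
        _ ≤ 1 / 10 := by
          rw [div_le_div_iff₀ (by positivity) (by norm_num)]
          linarith
    rw [hAP]
    linarith

theorem exists_tests_of_two_lt [NeZero n] {ε : ℝ} (hε : 2 < ε) (g : Fin n → Fin m) :
    ∃ A : QueryAlgorithm n m, A.queries = 0 ∧ A.Tests ε g := by
  obtain ⟨A, hAq, hAP⟩ := (Realizes.one (n := n) (m := m) Unit).exists_queryAlgorithm
  refine ⟨A, hAq, fun f => ⟨fun _ => by rw [hAP]; norm_num, fun h => ?_⟩⟩
  have h1 : l1Dist (inducedDist f) (inducedDist g) ≤ 2 := by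
    calc l1Dist (inducedDist f) (inducedDist g) ≤ ∑ j, (inducedDist f j + inducedDist g j) := by
          refine Finset.sum_le_sum fun j _ => (abs_sub _ _).trans_eq ?_
          rw [abs_of_nonneg (inducedDist_nonneg f j), abs_of_nonneg (inducedDist_nonneg g j)]
      _ = 2 := by
          rw [Finset.sum_add_distrib, sum_inducedDist, sum_inducedDist]
          norm_num
  linarith

/-- The number of queries is `O(m^(1/3) / ε^5)`. -/
theorem exists_tests_queries_le [NeZero n] (hm : 1 ≤ m) {ε : ℝ} (hε : 0 < ε) (g : Fin n → Fin m) :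
    ∃ A : QueryAlgorithm n m, A.Tests ε g ∧
      (A.queries : ℝ) ≤ 200000 * ((m : ℝ) ^ (1 / 3 : ℝ) / ε ^ 5) := by
  rcases lt_or_ge 2 ε with hε2 | hε2
  · obtain ⟨A, hAq, hA⟩ := exists_tests_of_two_lt hε2 g
    refine ⟨A, hA, ?_⟩
    rw [hAq, Nat.cast_zero]
    positivity
  have : NeZero m := ⟨by omega⟩
  set t : ℝ := (m : ℝ) ^ (1 / 3 : ℝ) with ht
  have ht1 : 1 ≤ t := Real.one_le_rpow (by exact_mod_cast hm) (by norm_num)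
  have ht3 : t ^ 3 = m := by
    rw [ht, ← Real.rpow_natCast, ← Real.rpow_mul (Nat.cast_nonneg m)]
    norm_num
  set s : ℕ := ⌈10240 * t / ε ^ 4⌉₊ with hs
  have hsle : 10240 * t / ε ^ 4 ≤ s := Nat.le_ceil _
  have hslt : (s : ℝ) < 10240 * t / ε ^ 4 + 1 := Nat.ceil_lt_add_one (by positivity)
  have hs' : 10240 * t ≤ s * ε ^ 4 := (div_le_iff₀ (by positivity)).1 hsle
  have hs0 : (0 : ℝ) < s := lt_of_lt_of_le (by positivity) hsle
  -- The second summand makes the expected truncation loss small enough for Markov's inequality.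
  set M : ℝ := m + 640 * s / ε ^ 2 with hM
  have hM0 : 0 < M := by positivity
  -- The two terms pay for the two summands of `M`: after multiplication by `ε^2` and squaring,
  -- `100^2 ≤ 10240` covers `m = t^3`, and `26^2 ≥ 640` covers `640 * s / ε^2`.
  set ρ : ℝ := 720 * (t / 100 + 26 / ε ^ 3) with hρ
  set K : ℕ := ⌈ρ⌉₊ with hK
  have hKle : ρ ≤ K := Nat.le_ceil _
  have hρ0 : 0 < ρ := by positivity
  have hKlt : (K : ℝ) < ρ + 1 := Nat.ceil_lt_add_one hρ0.le
  have : NeZero K := ⟨by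
    have : (0 : ℝ) < K := hρ0.trans_le hKle
    exact_mod_cast this.ne'⟩
  obtain ⟨A, hAq, hA⟩ := exists_tests (M := M) hε hε2 g s K
    (by rw [hM]; have : 0 ≤ 640 * s / ε ^ 2 := by positivity
        linarith)
    (by rw [hM, add_mul, div_mul_cancel₀ _ (by positivity)]
        have : 0 ≤ m * ε ^ 2 := by positivity
        linarith)
    (by nlinarith)
    (by
      have h1 : 1 ≤ (t / 100 + 26 / ε ^ 3) * (ε ^ 2 * Real.sqrt (s / M)) := by
        have h2 : M ≤ s * ((t / 100 + 26 / ε ^ 3) * ε ^ 2) ^ 2 := by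
          have h3 : ((t / 100 + 26 / ε ^ 3) * ε ^ 2) ^ 2 =
              t ^ 2 * ε ^ 4 / 10000 + 52 / 100 * t * ε + 676 / ε ^ 2 := by
            field_simp
            ring
          have h4 : (m : ℝ) ≤ s * (t ^ 2 * ε ^ 4 / 10000) := by
            have : 10240 * t * (t ^ 2 / 10000) ≤ s * ε ^ 4 * (t ^ 2 / 10000) := by gcongr
            rw [← ht3]
            have : 0 < t ^ 3 := by positivity
            linarith
          have h5 : 640 * s / ε ^ 2 ≤ s * (676 / ε ^ 2) := by
            rw [mul_div_assoc', mul_comm (s : ℝ) 676]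
            gcongr
            norm_num
          have h6 : 0 ≤ s * (52 / 100 * t * ε) := by positivity
          rw [h3, hM]
          linarith
        rw [← mul_assoc]
        set y := (t / 100 + 26 / ε ^ 3) * ε ^ 2 with hy
        have hy0 : 0 ≤ y := by positivity
        rw [← Real.sqrt_sq hy0, ← Real.sqrt_mul (sq_nonneg y)]
        rw [Real.one_le_sqrt, mul_div_assoc', one_le_div hM0]
        linarith
      have h2 : 0 ≤ ε ^ 2 * Real.sqrt (s / M) := by positivity
      calc (720 : ℝ) ≤ 720 * ((t / 100 + 26 / ε ^ 3) * (ε ^ 2 * Real.sqrt (s / M))) := by linarith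
        _ = ρ * (ε ^ 2 * Real.sqrt (s / M)) := by rw [hρ]; ring
        _ ≤ _ := mul_le_mul_of_nonneg_right hKle h2)
  refine ⟨A, hA, ?_⟩
  rw [hAq]
  push_cast
  -- As `ε ≤ 2`, all lower powers of `1 / ε` are absorbed into the fifth.
  have hx : ∀ k ≤ 5, 1 / ε ^ k ≤ 32 * (1 / ε ^ 5) * (1 / 2 ^ k) := by
    intro k hk
    have h1 : ε ^ (5 - k) ≤ 2 ^ (5 - k) := pow_le_pow_left₀ hε.le hε2 _
    have h2 : ε ^ 5 = ε ^ k * ε ^ (5 - k) := by rw [← pow_add]; congr 1; omega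
    have h3 : (32 : ℝ) = 2 ^ k * 2 ^ (5 - k) := by
      rw [← pow_add, show k + (5 - k) = 5 by omega]
      norm_num
    rw [h2, h3]
    have : 0 < ε ^ (5 - k) := by positivity
    calc 1 / ε ^ k = 1 / ε ^ k * (ε ^ (5 - k) / ε ^ (5 - k)) := by rw [div_self this.ne', mul_one]
      _ ≤ 1 / ε ^ k * (2 ^ (5 - k) / ε ^ (5 - k)) := by gcongr
      _ = _ := by field_simp
  have h0 := hx 0 (by norm_num)
  have h3 := hx 3 (by norm_num)
  have h4 := hx 4 (by norm_num)
  norm_num at h0 h3 h4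
  have hz : 0 < (ε ^ 5)⁻¹ := by positivity
  have hρ' : ρ = 7.2 * t * 1 + 18720 * (ε ^ 3)⁻¹ := by rw [hρ]; ring
  have hs4 : 10240 * t / ε ^ 4 = 10240 * (t * (ε ^ 4)⁻¹) := by ring
  rw [hs4] at hslt
  have e1 : t * (ε ^ 4)⁻¹ ≤ t * (2 * (ε ^ 5)⁻¹) := by
    refine mul_le_mul_of_nonneg_left ?_ (by linarith)
    linarith
  have e2 : (ε ^ 5)⁻¹ ≤ t * (ε ^ 5)⁻¹ := by nlinarith
  have e3 : t * 1 ≤ t * (32 * (ε ^ 5)⁻¹) := mul_le_mul_of_nonneg_left (by linarith) (by linarith)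
  rw [div_eq_mul_inv]
  linarith

end QueryAlgorithm

theorem theorem1 :
    ∃ C : ℝ, 0 < C ∧ ∃ p : MvPolynomial (Fin 2) ℝ,
      ∀ (n m : ℕ) (ε : ℝ) (g : Fin n → Fin m), 1 ≤ n → 3 ≤ m → 0 < ε →
        ∃ q : ℕ, quantumQueryComplexity ε g = q ∧
          (q : ℝ) ≤ C * ((m : ℝ) ^ (1 / 3 : ℝ) * Real.log m ^ 2 * Real.log (Real.log m) / ε ^ 5) ∧
          (q : ℝ) ≤ (m : ℝ) ^ (1 / 3 : ℝ) * MvPolynomial.eval ![1 / ε, Real.log m] p := by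
  have hlog3 : 1 < Real.log 3 := by
    rw [Real.lt_log_iff_exp_lt (by norm_num)]
    exact Real.exp_one_lt_three
  have hloglog3 : 0 < Real.log (Real.log 3) := Real.log_pos hlog3
  -- For `m ≥ 3` the logarithmic factors are at least `log (log 3)`, so dividing the constant by it
  -- makes the log-free bound suffice.
  refine ⟨200000 / Real.log (Real.log 3), by positivity,
    MvPolynomial.C 200000 * MvPolynomial.X 0 ^ 5, fun n m ε g hn hm hε => ?_⟩
  have : NeZero n := ⟨by omega⟩
  obtain ⟨A, hA, hq⟩ := QueryAlgorithm.exists_tests_queries_le (by omega) hε g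
  have hle : quantumQueryComplexity ε g ≤ A.queries := iInf₂_le A hA
  obtain ⟨q, hq'⟩ := ENat.ne_top_iff_exists.1 (ne_top_of_le_ne_top (ENat.natCast_ne_top _) hle)
  have hqA : (q : ℝ) ≤ A.queries := by
    rw [← hq'] at hle
    exact_mod_cast hle
  refine ⟨q, hq'.symm, ?_, ?_⟩
  · refine (hqA.trans hq).trans ?_
    have hm3 : Real.log 3 ≤ Real.log m :=
      Real.log_le_log (by norm_num) (by exact_mod_cast hm)
    have h1 : 1 ≤ Real.log m ^ 2 := one_le_pow₀ (hlog3.le.trans hm3)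
    have h2 : Real.log (Real.log 3) ≤ Real.log (Real.log m) := Real.log_le_log (by linarith) hm3
    have h3 : 1 ≤ Real.log m ^ 2 * (Real.log (Real.log m) / Real.log (Real.log 3)) :=
      one_le_mul_of_one_le_of_one_le h1 ((one_le_div hloglog3).2 h2)
    calc 200000 * ((m : ℝ) ^ (1 / 3 : ℝ) / ε ^ 5)
        ≤ 200000 * ((m : ℝ) ^ (1 / 3 : ℝ) / ε ^ 5) *
          (Real.log m ^ 2 * (Real.log (Real.log m) / Real.log (Real.log 3))) :=
          le_mul_of_one_le_right (by positivity) h3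
      _ = _ := by ring
  · refine (hqA.trans hq).trans_eq ?_
    simp
    ring
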